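/- \textbf{Setting.} Fix $d\ge 1$. For a non-empty finite alphabet $\mathcal A$, let $\Omega_{\mathcal A}=\mathcal A^{\mathbb Z^d}$ with its product topology and Borel $\sigma$-algebra, with the shifts $\sigma_k(\omega)_l=\omega_{k+l}$ ($k,l\in\mathbb Z^d$), and let $\mathcal M_{\mathcal A}$ be the set of shift-invariant probability measures on $\Omega_{\mathcal A}$. Write $B_n=\{-n,\dots,n\}^d$. For a finite set $\mathcal F$ of patterns $w\in\mathcal A^{I(w)}$ on finite windows $I(w)\subset\mathbb Z^d$, let $\Omega_{\mathcal F}$ be the subshift of finite type (SFT) of all $\omega\in\Omega_{\mathcal A}$ such that $\sigma_k(\omega)|_{I(w)}\ne w$ for all $w\in\mathcal F$, $k\in\mathbb Z^d$, and let $\mathcal M_{\mathcal F}$ be the set of $\mu\in\mathcal M_{\mathcal A}$ supported by $\Omega_{\mathcal F}$. All SFTs considered below are assumed non-empty. Two SFTs $\Omega_{\mathcal F}\subset\mathcal A_1^{\mathbb Z^d}$ and $\Omega_{\mathcal G}\subset\mathcal A_2^{\mathbb Z^d}$ are \emph{conjugate} if there is a continuous bijection $\theta:\Omega_{\mathcal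 F}\to\Omega_{\mathcal G}$ that commutes with all shifts. \textbf{Noise.} Let $\widetilde{\mathcal A}=\mathcal A\times\{0,1\}$, with coordinate projections $\pi_1,\pi_2$, applied cell by cell to configurations, and let $\widetilde{\mathcal F}=\{(w,0^{I(w)}):w\in\mathcal F\}$. For $\varepsilon\in[0,1]$, a measure $\nu\in\mathcal M_{\{0,1\}}$ is an \emph{$\varepsilon$-noise} if $\nu(\{b:b_0=1\})\le\varepsilon$. For a class of noises $\mathcal N\subset\mathcal M_{\{0,1\}}$, let $$\mathcal M_{\mathcal F}^{\mathcal N}(\varepsilon)=\{\pi_1^*(\lambda):\lambda\in\mathcal M_{\widetilde{\mathcal F}},\ \pi_2^*(\lambda)\in\mathcal N\text{ is an }\varepsilon\text{-noise}\},$$ where $^*$ denotes the push-forward of measures. For $n\in\mathbb N$, the \emph{thickening} $\gamma_n:\{0,1\}^{\mathbb Z^d}\to\{0,1\}^{\mathbb Z^d}$ is $\gamma_n(b)_c=\max_{k\in B_n}b_{c+k}$. \textbf{Distance and stability.} For $x,y\in\Omega_{\mathcal A}$ let $d_H(x,y)=\limsup_{n\to\infty}|\{k\in B_n:x_k\ne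 y_k\}|/|B_n|$. For $\mu,\nu\in\mathcal M_{\mathcal A}$ let $d_B(\mu,\nu)=\inf_\lambda\int d_H(x,y)\,\mathrm d\lambda(x,y)$, over all $\lambda\in\mathcal M_{\mathcal A\times\mathcal A}$ with marginals $\mu$ and $\nu$, and let $d_B(\mu,\mathcal M_{\mathcal F})=\inf_{\nu\in\mathcal M_{\mathcal F}}d_B(\mu,\nu)$. The SFT $\Omega_{\mathcal F}$ is \emph{stable} on $\mathcal N$ if there is a non-decreasing $f:[0,1]\to[0,\infty)$, right-continuous at $0$ with $f(0)=0$, such that $$\sup_{\mu\in\mathcal M_{\mathcal F}^{\mathcal N}(\varepsilon)}d_B(\mu,\mathcal M_{\mathcal F})\le f(\varepsilon)\qquad\text{for all }\varepsilon\in[0,1].$$ It is \emph{linearly stable} (resp. \emph{polynomially stable}) on $\mathcal N$ if $f$ can moreover be chosen with $f(\varepsilon)=O(\varepsilon)$ (resp. $f(\varepsilon)=O(\varepsilon^\alpha)$ for some $0<\alpha\le1$) as $\varepsilon\to0$. (These notions refer to the given set of forbidden patterns.) \textbf{Corollary (Conjugacy-Invariance for Stable Noise Classes).} Let $\mathcal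 F$ and $\mathcal G$ be finite sets of forbidden patterns, over possibly different non-empty finite alphabets but on the same grid $\mathbb Z^d$, such that the SFTs $\Omega_{\mathcal F}$ and $\Omega_{\mathcal G}$ are non-empty and conjugate. Let $\mathcal N\subset\mathcal M_{\{0,1\}}$ be a class of noises such that $\gamma_n^*(\nu)\in\mathcal N$ for all $\nu\in\mathcal N$ and $n\in\mathbb N$. Then $\Omega_{\mathcal F}$ is stable (resp. linearly stable, polynomially stable) on $\mathcal N$ if and only if $\Omega_{\mathcal G}$ is. In particular, the class $\mathcal N=\mathcal M_{\{0,1\}}$ of all noises is closed under every $\gamma_n$, so these three equivalences hold on it. -/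

import Mathlib

open MeasureTheory Topology SymbolicDynamics.FullShift
open scoped ENNReal NNReal

namespace NoisySFT

/-- The grid `ℤ^d`. -/
abbrev Grid (d : ℕ) : Type := Fin d → ℤ

/-- The full-shift configuration space `A^(ℤ^d)`, with its product topology and product
sigma-algebra (which is the Borel one for a finite discrete alphabet). -/
abbrev Config (d : ℕ) (A : Type*) : Type _ := Grid d → A

/-- Letter-by-letter application of a map of alphabets to a configuration. For `Prod.fst` and
`Prod.snd` these are the canonical projections of configurations on a product alphabet. -/
def letterMap {d : ℕ} {A B : Type*} (p : A → B) (x : Config d A) : Config d B := fun k => p (x k)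

/-- The box `B_n = [-n, n]^d`. -/
noncomputable def box (d n : ℕ) : Finset (Grid d) := Finset.Icc (fun _ => -(n : ℤ)) (fun _ => (n : ℤ))

/-! ### Invariant measures -/

/-- The shift-invariant probability measures on the full shift with alphabet `A`. -/
def invariantMeasures (d : ℕ) (A : Type*) [MeasurableSpace A] : Set (Measure (Config d A)) :=
  {μ | IsProbabilityMeasure μ ∧ ∀ k : Grid d, μ.map (shift k) = μ}

/-- The shift-invariant probability measures supported by the subshift that avoids the patterns
of `F`. -/
def sftMeasures {d : ℕ} {A : Type*} [Inhabited A] [MeasurableSpace A]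
    (F : Set (Pattern A (Grid d))) : Set (Measure (Config d A)) :=
  {μ | μ ∈ invariantMeasures d A ∧ ∀ᵐ x ∂μ, x ∈ forbidden F}

/-! ### Noise. In the alphabet `A × Bool`, the letter `(a, false)` is clear and the letter
`(a, true)` is obscured. -/

/-- The clear version `(w, 0)` of a pattern `w`. The value `(default, false)` is the default letter
of `A × Bool`, which is the filler that patterns have outside their window. -/
def clearPattern {d : ℕ} {A : Type*} [Inhabited A] (w : Pattern A (Grid d)) :
    Pattern (A × Bool) (Grid d) where
  config := fun k => (w.config k, false)
  support := w.support
  condition := fun k hk => by rw [w.condition k hk]; rfl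

/-- The set of forbidden clear patterns. -/
def clearPatterns {d : ℕ} {A : Type*} [Inhabited A] (F : Set (Pattern A (Grid d))) :
    Set (Pattern (A × Bool) (Grid d)) :=
  clearPattern '' F

/-- `ν` is an `ε`-noise: a shift-invariant probability measure on `{0,1}^(ℤ^d)` for which a given
cell is obscured with probability at most `ε`. -/
def IsNoise {d : ℕ} (ε : unitInterval) (ν : Measure (Config d Bool)) : Prop :=
  ν ∈ invariantMeasures d Bool ∧ ν {b | b 0 = true} ≤ ENNReal.ofReal (ε : ℝ)

/-- The noisy measures on the alphabet `A × Bool`, with an `ε`-noise of the class `N`. -/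
def noisyMeasuresTilde {d : ℕ} {A : Type*} [Inhabited A] [MeasurableSpace A]
    (F : Set (Pattern A (Grid d))) (N : Set (Measure (Config d Bool))) (ε : unitInterval) :
    Set (Measure (Config d (A × Bool))) :=
  {m | m ∈ sftMeasures (clearPatterns F) ∧
    m.map (letterMap Prod.snd) ∈ N ∧ IsNoise ε (m.map (letterMap Prod.snd))}

/-- The projections to the alphabet `A` of the noisy measures. -/
def noisyMeasures {d : ℕ} {A : Type*} [Inhabited A] [MeasurableSpace A]
    (F : Set (Pattern A (Grid d))) (N : Set (Measure (Config d Bool))) (ε : unitInterval) :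
    Set (Measure (Config d A)) :=
  (fun m => m.map (letterMap Prod.fst)) '' noisyMeasuresTilde F N ε

/-- The thickening `γ_n`: a cell is obscured in `γ_n b` when some cell of its `n`-neighbourhood is
obscured in `b`. -/
noncomputable def thicken {d : ℕ} (n : ℕ) (b : Config d Bool) : Config d Bool :=
  fun c => (box d n).sup (fun k => b (c + k))

/-- The class `N` is closed under every thickening. -/
def ClosedUnderThickening {d : ℕ} (N : Set (Measure (Config d Bool))) : Prop :=
  ∀ n : ℕ, ∀ ν ∈ N, ν.map (thicken n) ∈ N

/-! ### The Besicovitch distance -/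

open Classical in
/-- The Hamming distance on the finite window `I`: the proportion of cells of `I` at which the two
configurations differ. -/
noncomputable def windowDist {d : ℕ} {A : Type*} (I : Finset (Grid d)) (x y : Config d A) : ℝ≥0∞ :=
  ((I.filter (fun k => x k ≠ y k)).card : ℝ≥0∞) / (I.card : ℝ≥0∞)

/-- The Hamming-Besicovitch pseudo-distance (along the boxes `B_n`). -/
noncomputable def hammingBesicovitch {d : ℕ} {A : Type*} (x y : Config d A) : ℝ≥0∞ :=
  Filter.limsup (fun n : ℕ => windowDist (box d n) x y) Filter.atTop

/-- The couplings of `μ` and `ν`: shift-invariant probability measures on the full shift with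
alphabet `A × A` whose two marginals are `μ` and `ν`. -/
def couplings {d : ℕ} {A : Type*} [MeasurableSpace A] (μ ν : Measure (Config d A)) :
    Set (Measure (Config d (A × A))) :=
  {m | m ∈ invariantMeasures d (A × A) ∧
    m.map (letterMap Prod.fst) = μ ∧ m.map (letterMap Prod.snd) = ν}

/-- The Besicovitch distance on shift-invariant probability measures. -/
noncomputable def besicovitchDist {d : ℕ} {A : Type*} [MeasurableSpace A]
    (μ ν : Measure (Config d A)) : ℝ≥0∞ :=
  ⨅ m ∈ couplings μ ν, ∫⁻ z, hammingBesicovitch (letterMap Prod.fst z) (letterMap Prod.snd z) ∂m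

/-- The Besicovitch distance from `μ` to a set of measures. -/
noncomputable def besicovitchDistTo {d : ℕ} {A : Type*} [MeasurableSpace A]
    (μ : Measure (Config d A)) (S : Set (Measure (Config d A))) : ℝ≥0∞ :=
  ⨅ ν ∈ S, besicovitchDist μ ν

/-! ### Stability -/

/-- `f : [0,1] → ℝ≥0` is non-decreasing, with `f 0 = 0`, and right-continuous at `0`. -/
structure IsSpeed (f : unitInterval → ℝ≥0) : Prop where
  monotone : Monotone f
  map_zero : f 0 = 0
  continuousAt_zero : ContinuousAt f 0

/-- `f`-stability on the class `N`, for the Besicovitch distance. -/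
def StableWithSpeed {d : ℕ} {A : Type*} [Inhabited A] [MeasurableSpace A]
    (F : Set (Pattern A (Grid d))) (N : Set (Measure (Config d Bool)))
    (f : unitInterval → ℝ≥0) : Prop :=
  ∀ ε : unitInterval,
    ⨆ μ ∈ noisyMeasures F N ε, besicovitchDistTo μ (sftMeasures F) ≤ (f ε : ℝ≥0∞)

/-- Stability on the class `N`. -/
def Stable {d : ℕ} {A : Type*} [Inhabited A] [MeasurableSpace A]
    (F : Set (Pattern A (Grid d))) (N : Set (Measure (Config d Bool))) : Prop :=
  ∃ f : unitInterval → ℝ≥0, IsSpeed f ∧ StableWithSpeed F N f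

/-- Linear stability on the class `N`. -/
def LinearlyStable {d : ℕ} {A : Type*} [Inhabited A] [MeasurableSpace A]
    (F : Set (Pattern A (Grid d))) (N : Set (Measure (Config d Bool))) : Prop :=
  ∃ f : unitInterval → ℝ≥0, IsSpeed f ∧ StableWithSpeed F N f ∧
    (fun ε => (f ε : ℝ)) =O[𝓝 0] (fun ε : unitInterval => (ε : ℝ))

/-- Polynomial stability on the class `N`. -/
def PolynomiallyStable {d : ℕ} {A : Type*} [Inhabited A] [MeasurableSpace A]
    (F : Set (Pattern A (Grid d))) (N : Set (Measure (Config d Bool))) : Prop :=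
  ∃ f : unitInterval → ℝ≥0, IsSpeed f ∧ StableWithSpeed F N f ∧
    ∃ α : ℝ, 0 < α ∧ α ≤ 1 ∧
      (fun ε => (f ε : ℝ)) =O[𝓝 0] (fun ε : unitInterval => (ε : ℝ) ^ α)

/-! ### Conjugacy -/

/-- A morphism of subshifts: a continuous map that commutes with all shifts. -/
structure IsMorphism {d : ℕ} {A₁ A₂ : Type*} [Inhabited A₁] [Inhabited A₂]
    [TopologicalSpace A₁] [TopologicalSpace A₂]
    (F : Set (Pattern A₁ (Grid d))) (G : Set (Pattern A₂ (Grid d)))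
    (θ : forbidden F → forbidden G) : Prop where
  continuous : Continuous θ
  commutes : ∀ (k : Grid d) (x : forbidden F),
    (θ ⟨shift k x.1, Pattern.mapsTo_shift_forbidden F k x.2⟩).1 = shift k (θ x).1

/-- Two subshifts are conjugate when there is a bijective morphism from one to the other. -/
def Conjugate {d : ℕ} {A₁ A₂ : Type*} [Inhabited A₁] [Inhabited A₂]
    [TopologicalSpace A₁] [TopologicalSpace A₂]
    (F : Set (Pattern A₁ (Grid d))) (G : Set (Pattern A₂ (Grid d))) : Prop :=
  ∃ θ : forbidden F → forbidden G, IsMorphism F G θ ∧ Function.Bijective θ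

end NoisySFT

namespace NoisySFT

/-! ### Boxes -/

section Boxes

variable {d : ℕ}

/-! By compactness a conjugacy and its inverse are block codes: `ψ` from `Ω_F` to `Ω_G` and `χ`
back. To carry stability from `F` to `G`, take a noisy measure `m` for `G`, apply `χ` to its letters
and the thickening `γ_n` to its noise. A cell left clear by `γ_n` had a clear box of radius `n`
around it, and for large `n` the letters near it agree with a genuine point of `Ω_G`
(`exists_radius_clear`, again compactness). There `χ` creates no forbidden pattern and `ψ` undoes
it. So the image is a noisy measure for `F`, with noise still in the class and of density at most
`|B_n| ε` (`IsNoisyInverse.map_noisyCode_mem`).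

Stability of `F` provides couplings of this image with some `ν` in `M_F`. Such a coupling is lifted
through `χ` to an invariant coupling of `m` itself with `ν`, by disintegration (`glue`,
`map_prodMap_glue`); applying `ψ` to `ν` lands in `M_G`. A disagreement at a cell then comes from
noise within `n` of it, or from a disagreement of the `F`-side coupling within `r` of it
(`IsNoisyInverse.hammingBesicovitch_le`).

The mean upper density of the noise remains to be bounded. A limsup sits inside the integral, so the
reverse Fatou inequality goes the wrong way. Since constants are harmless, a maximal inequality from
a Vitali covering suffices in place of an ergodic theorem (`lintegral_upperDensity_le`). The outcome
is the speed `a ε + b f(min(1, c ε))`, which preserves all three notions of stability; exchanging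
the roles of `F` and `G` gives the converse. -/

lemma mem_box {n : ℕ} {k : Grid d} : k ∈ box d n ↔ ∀ i, -(n : ℤ) ≤ k i ∧ k i ≤ n := by
  simp [box, Pi.le_def, forall_and]

lemma box_mono {m n : ℕ} (h : m ≤ n) : box d m ⊆ box d n := by
  intro k hk
  rw [mem_box] at *
  intro i
  have := hk i
  omega

lemma zero_mem_box (n : ℕ) : (0 : Grid d) ∈ box d n := by
  rw [mem_box]; intro i; simp

lemma add_mem_box {m n : ℕ} {k l : Grid d} (hk : k ∈ box d m) (hl : l ∈ box d n) :
    k + l ∈ box d (m + n) := by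
  rw [mem_box] at *
  intro i
  have := hk i
  have := hl i
  simp only [Pi.add_apply]
  push_cast
  omega

lemma neg_mem_box {n : ℕ} {k : Grid d} (hk : k ∈ box d n) : -k ∈ box d n := by
  rw [mem_box] at *
  intro i
  have := hk i
  simp only [Pi.neg_apply]
  omega

lemma sub_mem_box {m n : ℕ} {k l : Grid d} (hk : k ∈ box d m) (hl : l ∈ box d n) :
    k - l ∈ box d (m + n) := by
  rw [sub_eq_add_neg]; exact add_mem_box hk (neg_mem_box hl)

lemma exists_mem_box (k : Grid d) : ∃ n, k ∈ box d n := by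
  refine ⟨∑ i, (k i).natAbs, mem_box.2 fun i => ?_⟩
  have h : (k i).natAbs ≤ ∑ i, (k i).natAbs :=
    Finset.single_le_sum (f := fun i => (k i).natAbs) (fun _ _ => Nat.zero_le _) (Finset.mem_univ i)
  omega

lemma exists_subset_box (s : Finset (Grid d)) : ∃ n, s ⊆ box d n := by
  choose n hn using exists_mem_box (d := d)
  exact ⟨s.sup n, fun k hk => box_mono (Finset.le_sup hk) (hn k)⟩

lemma card_box (n : ℕ) : (box d n).card = (2 * n + 1) ^ d := by
  rw [box, Pi.card_Icc]
  simp only [Int.card_Icc, Finset.prod_const, Finset.card_univ, Fintype.card_fin]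
  congr 1
  omega

lemma card_box_pos (n : ℕ) : 0 < (box d n).card := by
  rw [card_box]; positivity

lemma card_box_two_mul_le (n : ℕ) : (box d (2 * n)).card ≤ 2 ^ d * (box d n).card := by
  rw [card_box, card_box, ← mul_pow]
  exact Nat.pow_le_pow_left (by omega) d

lemma card_box_ne_zero (n : ℕ) : ((box d n).card : ℝ≥0∞) ≠ 0 := by
  exact_mod_cast (card_box_pos n).ne'

/-- A finite Vitali covering lemma for the boxes `k + B_(r k)`. -/
lemma exists_disjoint_boxes (r : Grid d → ℕ) (T : Finset (Grid d)) :
    ∃ U ⊆ T, (∀ u ∈ U, ∀ v ∈ U, u ≠ v → ∀ l, l - u ∈ box d (r u) → l - v ∉ box d (r v)) ∧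
      ∀ k ∈ T, ∃ u ∈ U, k - u ∈ box d (2 * r u) := by
  classical
  induction T using Finset.strongInduction with
  | H T ih =>
    rcases T.eq_empty_or_nonempty with rfl | hT
    · exact ⟨∅, by simp⟩
    obtain ⟨u, huT, hu⟩ := T.exists_max_image r hT
    -- Greedy selection: keep a centre `u` of largest radius, discard every centre whose box meets
    -- that of `u`, and recurse on the rest.
    set T' := T.filter (fun k => ∀ l, l - u ∈ box d (r u) → l - k ∉ box d (r k)) with hT'
    have huT' : u ∉ T' := fun h => by
      have := (Finset.mem_filter.1 h).2 u (by simpa using zero_mem_box _)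
      exact this (by simpa using zero_mem_box _)
    obtain ⟨U, hUT, hdis, hcov⟩ := ih T' ((Finset.ssubset_iff_of_subset (Finset.filter_subset _ _)).2
      ⟨u, huT, huT'⟩)
    have hU : ∀ v ∈ U, ∀ l, l - u ∈ box d (r u) → l - v ∉ box d (r v) := fun v hv =>
      (Finset.mem_filter.1 (hUT hv)).2
    refine ⟨insert u U, ?_, ?_, ?_⟩
    · exact Finset.insert_subset huT (hUT.trans (Finset.filter_subset _ _))
    · intro a ha b hb hab l hla hlb
      rcases Finset.mem_insert.1 ha with rfl | ha
      · rcases Finset.mem_insert.1 hb with rfl | hb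
        · exact hab rfl
        · exact hU b hb l hla hlb
      · rcases Finset.mem_insert.1 hb with rfl | hb
        · exact hU a ‹_› l hlb hla
        · exact hdis a ha b hb hab l hla hlb
    · intro k hk
      by_cases hkT : k ∈ T'
      · obtain ⟨v, hv, h⟩ := hcov k hkT
        exact ⟨v, Finset.mem_insert_of_mem hv, h⟩
      · have : ∃ l, l - u ∈ box d (r u) ∧ l - k ∈ box d (r k) := by
          by_contra hcon
          push Not at hcon
          exact hkT (Finset.mem_filter.2 ⟨hk, hcon⟩)
        obtain ⟨l, hlu, hlk⟩ := this
        refine ⟨u, Finset.mem_insert_self _ _, ?_⟩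
        -- The two boxes share `l` and `r k ≤ r u` by maximality, so `k - u = (l - u) - (l - k)` has
        -- size at most `2 * r u`.
        have h := box_mono (by have := hu k hk; omega : r u + r k ≤ 2 * r u) (sub_mem_box hlu hlk)
        simpa using h

end Boxes

/-! ### Upper density -/

section Density

variable {d : ℕ}

open Classical in
/-- The number of points of `S` in the box `B_n`. -/
noncomputable def boxCount (n : ℕ) (S : Set (Grid d)) : ℕ := ((box d n).filter (· ∈ S)).card

/-- The upper density of a set of cells, along the boxes `B_n`. -/
noncomputable def upperDensity (S : Set (Grid d)) : ℝ≥0∞ :=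
  Filter.limsup (fun n : ℕ => (boxCount n S : ℝ≥0∞) / ((box d n).card : ℝ≥0∞)) Filter.atTop

lemma boxCount_eq_card (n : ℕ) (S : Set (Grid d)) [DecidablePred (· ∈ S)] :
    boxCount n S = ((box d n).filter (· ∈ S)).card := by
  unfold boxCount; congr

lemma hammingBesicovitch_eq {A : Type*} (x y : Config d A) :
    hammingBesicovitch x y = upperDensity {k | x k ≠ y k} := by
  classical
  unfold hammingBesicovitch upperDensity windowDist
  simp only [boxCount_eq_card, Set.mem_ofPred_eq]

lemma boxCount_mono {n : ℕ} {S T : Set (Grid d)} (h : S ⊆ T) : boxCount n S ≤ boxCount n T := by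
  classical
  exact Finset.card_le_card (Finset.monotone_filter_right _ fun _ _ hk => h hk)

lemma boxCount_union_le (n : ℕ) (S T : Set (Grid d)) :
    boxCount n (S ∪ T) ≤ boxCount n S + boxCount n T := by
  classical
  unfold boxCount
  refine le_trans (le_of_eq ?_) (Finset.card_union_le _ _)
  congr 1
  ext k
  simp only [Finset.mem_filter, Finset.mem_union, Set.mem_union]
  tauto

lemma boxCount_translate_le {n r : ℕ} {j : Grid d} (hj : j ∈ box d r) (S : Set (Grid d)) :
    boxCount n {k | k + j ∈ S} ≤ boxCount (n + r) S := by
  classical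
  refine Finset.card_le_card_of_injOn (fun k => k + j) ?_ (fun a _ b _ h => add_right_cancel h)
  intro k hk
  have hk := Finset.mem_filter.1 (Finset.mem_coe.1 hk)
  exact Finset.mem_coe.2 (Finset.mem_filter.2 ⟨add_mem_box hk.1 hj, hk.2⟩)

lemma boxCount_le (n : ℕ) (S : Set (Grid d)) : boxCount n S ≤ (box d n).card := by
  classical
  exact Finset.card_filter_le _ _

lemma upperDensity_le_one (S : Set (Grid d)) : upperDensity S ≤ 1 := by
  refine (Filter.limsup_le_limsup (v := fun _ => (1 : ℝ≥0∞)) (Filter.Eventually.of_forall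
    fun n => ?_)).trans (by simp)
  refine ENNReal.div_le_of_le_mul ?_
  rw [one_mul]
  exact_mod_cast boxCount_le n S

lemma upperDensity_mono {S T : Set (Grid d)} (h : S ⊆ T) : upperDensity S ≤ upperDensity T := by
  refine Filter.limsup_le_limsup (Filter.Eventually.of_forall fun n => ?_)
  exact ENNReal.div_le_div_right (by exact_mod_cast boxCount_mono h) _

lemma upperDensity_empty : upperDensity (∅ : Set (Grid d)) = 0 := by
  simp [upperDensity, boxCount]

lemma upperDensity_union_le (S T : Set (Grid d)) :
    upperDensity (S ∪ T) ≤ upperDensity S + upperDensity T := by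
  refine ENNReal.le_of_forall_pos_le_add fun δ hδ _ => ?_
  have hlt : ∀ R : Set (Grid d), upperDensity R < upperDensity R + (δ / 2 : ℝ≥0) := fun R =>
    ENNReal.lt_add_right ((upperDensity_le_one R).trans_lt ENNReal.one_lt_top).ne
      (by exact_mod_cast (half_pos hδ).ne')
  refine Filter.limsup_le_of_le (by isBoundedDefault) ?_
  filter_upwards [Filter.eventually_lt_of_limsup_lt (hlt S) (by isBoundedDefault),
    Filter.eventually_lt_of_limsup_lt (hlt T) (by isBoundedDefault)] with n hS hT
  calc (boxCount n (S ∪ T) : ℝ≥0∞) / (box d n).card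
      ≤ (boxCount n S : ℝ≥0∞) / (box d n).card + (boxCount n T : ℝ≥0∞) / (box d n).card := by
        rw [← ENNReal.add_div]
        exact ENNReal.div_le_div_right (by exact_mod_cast boxCount_union_le n S T) _
    _ ≤ _ := add_le_add hS.le hT.le
    _ = upperDensity S + upperDensity T + ((δ / 2 + δ / 2 : ℝ≥0) : ℝ≥0∞) := by push_cast; ring
    _ = _ := by rw [add_halves]

/-- A translate of `B_n` by a vector of `B_r` lies in `B_(n+r)`, which for `n ≥ r` has at most `2 ^
d` times as many cells. The factor is not sharp, but only a constant is needed. -/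
lemma upperDensity_translate_le (j : Grid d) (S : Set (Grid d)) :
    upperDensity {k | k + j ∈ S} ≤ 2 ^ d * upperDensity S := by
  obtain ⟨r, hr⟩ := exists_mem_box j
  have h1 : upperDensity S = Filter.limsup (fun n : ℕ =>
      (boxCount (n + r) S : ℝ≥0∞) / ((box d (n + r)).card : ℝ≥0∞)) Filter.atTop :=
    (Filter.limsup_nat_add (fun n : ℕ => (boxCount n S : ℝ≥0∞) / ((box d n).card : ℝ≥0∞)) r).symm
  rw [h1, ← ENNReal.limsup_const_mul_of_ne_top (by simp)]
  refine Filter.limsup_le_limsup ?_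
  filter_upwards [Filter.eventually_ge_atTop r] with n hn
  have hc : (box d (n + r)).card ≤ 2 ^ d * (box d n).card :=
    (Finset.card_le_card (box_mono (by omega))).trans (card_box_two_mul_le n)
  rw [ENNReal.div_le_iff (card_box_ne_zero n) (ENNReal.natCast_ne_top _)]
  calc (boxCount n {k | k + j ∈ S} : ℝ≥0∞) ≤ boxCount (n + r) S := by
        exact_mod_cast boxCount_translate_le hr S
    _ = (boxCount (n + r) S : ℝ≥0∞) / ((box d (n + r)).card : ℝ≥0∞) * (box d (n + r)).card :=
        (ENNReal.div_mul_cancel (card_box_ne_zero _) (ENNReal.natCast_ne_top _)).symm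
    _ ≤ (boxCount (n + r) S : ℝ≥0∞) / ((box d (n + r)).card : ℝ≥0∞) *
          (2 ^ d * (box d n).card) := by gcongr; exact_mod_cast hc
    _ = _ := by ring

/-- Thickening a set of cells multiplies its upper density by a bounded factor at most. -/
lemma upperDensity_thicken_le (J : Finset (Grid d)) (S : Set (Grid d)) :
    upperDensity {k | ∃ j ∈ J, k + j ∈ S} ≤ J.card * 2 ^ d * upperDensity S := by
  classical
  induction J using Finset.induction_on with
  | empty => simp [upperDensity_empty]
  | insert j J hj ih =>
    have : {k | ∃ i ∈ insert j J, k + i ∈ S} = {k | k + j ∈ S} ∪ {k | ∃ i ∈ J, k + i ∈ S} := by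
      ext k; simp
    rw [this, Finset.card_insert_of_notMem hj]
    refine (upperDensity_union_le _ _).trans ((add_le_add (upperDensity_translate_le j S) ih).trans
      (le_of_eq ?_))
    push_cast
    ring

lemma upperDensity_shift_le (k : Grid d) (b : Config d Bool) :
    upperDensity {l | shift k b l = true} ≤ 2 ^ d * upperDensity {l | b l = true} := by
  have : {l | shift k b l = true} = {l | l + k ∈ {l | b l = true}} := by
    ext l; simp [add_comm]
  rw [this]
  exact upperDensity_translate_le _ _

lemma upperDensity_le_shift (k : Grid d) (b : Config d Bool) :
    upperDensity {l | b l = true} ≤ 2 ^ d * upperDensity {l | shift k b l = true} := by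
  have := upperDensity_shift_le (-k) (shift k b)
  rwa [← shift_add, add_neg_cancel, shift_zero] at this

end Density

/-! ### A maximal inequality -/

section Maximal

variable {d : ℕ}

/-- The configurations whose upper density is nearly attained in a box of radius at most `M`. -/
def nearlyAttained (d M : ℕ) : Set (Config d Bool) :=
  {b | ∃ n ≤ M, upperDensity {l | b l = true} * (box d n).card ≤ 2 * boxCount n {l | b l = true}}

lemma nearlyAttained_mono : Monotone (nearlyAttained d) :=
  fun _ _ h _ ⟨n, hn, hb⟩ => ⟨n, hn.trans h, hb⟩

/-- A positive finite limsup exceeds its own half, so some box has density above that half. Zero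
density is treated apart, since there the half is not strictly smaller. -/
lemma exists_mem_nearlyAttained (b : Config d Bool) : ∃ M, b ∈ nearlyAttained d M := by
  set D := upperDensity {l | b l = true} with hD
  rcases eq_or_ne D 0 with h0 | h0
  · exact ⟨0, 0, le_rfl, by simp [← hD, h0]⟩
  have hfin : D ≠ ∞ := ((upperDensity_le_one _).trans_lt ENNReal.one_lt_top).ne
  have hlt : D / 2 < upperDensity {l | b l = true} := ENNReal.half_lt_self h0 hfin
  obtain ⟨n, hn⟩ := (Filter.frequently_lt_of_lt_limsup (by isBoundedDefault) hlt).exists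
  refine ⟨n, n, le_rfl, ?_⟩
  rw [ENNReal.lt_div_iff_mul_lt (Or.inl (card_box_ne_zero n))
    (Or.inl (ENNReal.natCast_ne_top _))] at hn
  calc D * (box d n).card = 2 * (D / 2 * (box d n).card) := by
        rw [← mul_assoc, ENNReal.mul_div_cancel two_ne_zero ENNReal.ofNat_ne_top]
    _ ≤ _ := by gcongr

/-- The pointwise form of the maximal inequality, from the covering lemma. -/
lemma card_mul_upperDensity_le (M : ℕ) (b : Config d Bool) (T : Finset (Grid d))
    (hT : T ⊆ box d M) (hTM : ∀ k ∈ T, shift k b ∈ nearlyAttained d M) :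
    (T.card : ℝ≥0∞) * upperDensity {l | b l = true} ≤
      2 * 2 ^ d * 2 ^ d * boxCount (2 * M) {l | b l = true} := by
  classical
  set D := upperDensity {l | b l = true} with hD
  -- Near-attainment concerns the shifted configuration, whose density is compared with `D` at the
  -- cost of `2 ^ d`. The implication makes the radius a total function, with a dummy value off `T`.
  have hr : ∀ k, ∃ n, k ∈ T → n ≤ M ∧
      ((box d n).card : ℝ≥0∞) * D ≤ 2 * 2 ^ d * boxCount n {l | shift k b l = true} := by
    intro k
    by_cases hk : k ∈ T
    · obtain ⟨n, hn, h⟩ := hTM k hk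
      refine ⟨n, fun _ => ⟨hn, ?_⟩⟩
      calc ((box d n).card : ℝ≥0∞) * D
          ≤ (box d n).card * (2 ^ d * upperDensity {l | shift k b l = true}) := by
            gcongr; exact upperDensity_le_shift k b
        _ = 2 ^ d * (upperDensity {l | shift k b l = true} * (box d n).card) := by ring
        _ ≤ 2 ^ d * (2 * boxCount n {l | shift k b l = true}) := by gcongr
        _ = _ := by ring
    · exact ⟨0, fun h => absurd h hk⟩
  choose r hr using hr
  obtain ⟨U, hUT, hdis, hcov⟩ := exists_disjoint_boxes r T
  have hcard : T.card ≤ 2 ^ d * ∑ u ∈ U, (box d (r u)).card := by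
    calc T.card ≤ (U.biUnion fun u => (box d (2 * r u)).image (u + ·)).card := by
          refine Finset.card_le_card fun k hk => ?_
          obtain ⟨u, hu, h⟩ := hcov k hk
          exact Finset.mem_biUnion.2 ⟨u, hu, Finset.mem_image.2 ⟨k - u, h, by abel⟩⟩
      _ ≤ ∑ u ∈ U, ((box d (2 * r u)).image (u + ·)).card := Finset.card_biUnion_le
      _ ≤ ∑ u ∈ U, 2 ^ d * (box d (r u)).card :=
          Finset.sum_le_sum fun u _ => Finset.card_image_le.trans (card_box_two_mul_le _)
      _ = _ := by rw [Finset.mul_sum]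
  -- The selected boxes are disjoint, with centres in `B_M` and radii at most `M`, so their points
  -- are counted once and inside `B_(2M)`.
  have hcount : ∑ u ∈ U, boxCount (r u) {l | shift u b l = true} ≤
      boxCount (2 * M) {l | b l = true} := by
    have h1 : ∀ u, boxCount (r u) {l | shift u b l = true} =
        (((box d (r u)).filter (fun l => shift u b l = true)).image (u + ·)).card := fun u => by
      rw [Finset.card_image_of_injective _ (add_right_injective u)]
      rw [boxCount_eq_card]
      congr 1
    simp_rw [h1]
    rw [boxCount_eq_card, ← Finset.card_biUnion]
    · refine Finset.card_le_card fun k hk => ?_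
      obtain ⟨u, hu, hk⟩ := Finset.mem_biUnion.1 hk
      obtain ⟨l, hl, rfl⟩ := Finset.mem_image.1 hk
      obtain ⟨hl, hbl⟩ := Finset.mem_filter.1 hl
      refine Finset.mem_filter.2 ⟨?_, hbl⟩
      have := add_mem_box (hT (hUT hu)) (box_mono (hr u (hUT hu)).1 hl)
      rwa [two_mul]
    · intro u hu v hv huv
      refine Finset.disjoint_left.2 ?_
      intro k hku hkv
      obtain ⟨l, hl, rfl⟩ := Finset.mem_image.1 hku
      obtain ⟨l', hl', h⟩ := Finset.mem_image.1 hkv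
      refine hdis u hu v hv huv (u + l) ?_ ?_
      · simpa using (Finset.mem_filter.1 hl).1
      · rw [← h]; simpa using (Finset.mem_filter.1 hl').1
  calc (T.card : ℝ≥0∞) * D ≤ ((2 ^ d * ∑ u ∈ U, (box d (r u)).card : ℕ) : ℝ≥0∞) * D := by
        gcongr
    _ = 2 ^ d * ∑ u ∈ U, ((box d (r u)).card : ℝ≥0∞) * D := by
        push_cast; rw [mul_assoc, Finset.sum_mul]
    _ ≤ 2 ^ d * ∑ u ∈ U, 2 * 2 ^ d * (boxCount (r u) {l | shift u b l = true} : ℝ≥0∞) := by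
        gcongr 2 ^ d * ?_
        exact Finset.sum_le_sum fun u hu => (hr u (hUT hu)).2
    _ = 2 * 2 ^ d * 2 ^ d * ((∑ u ∈ U, boxCount (r u) {l | shift u b l = true} : ℕ) : ℝ≥0∞) := by
        push_cast; rw [← Finset.mul_sum]; ring
    _ ≤ _ := by gcongr

/-! ### Measurability and invariance -/

variable {A B : Type*} [MeasurableSpace A] [MeasurableSpace B]

lemma measurable_shift (k : Grid d) : Measurable (shift k : Config d A → Config d A) :=
  measurable_pi_lambda _ fun l => measurable_pi_apply (k + l)

lemma measurable_letterMap {p : A → B} (hp : Measurable p) :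
    Measurable (letterMap p : Config d A → Config d B) :=
  measurable_pi_lambda _ fun l => hp.comp (measurable_pi_apply l)

lemma measurable_boxCount {X : Type*} [MeasurableSpace X] {S : X → Set (Grid d)}
    (hS : ∀ k, MeasurableSet {x | k ∈ S x}) (n : ℕ) : Measurable fun x => boxCount n (S x) := by
  classical
  have : (fun x => boxCount n (S x)) = fun x => ∑ k ∈ box d n, if k ∈ S x then 1 else 0 := by
    funext x
    rw [boxCount_eq_card, Finset.card_filter]
  rw [this]
  exact Finset.measurable_fun_sum _ fun k _ =>
    Measurable.ite (hS k) measurable_const measurable_const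

lemma measurable_upperDensity {X : Type*} [MeasurableSpace X] {S : X → Set (Grid d)}
    (hS : ∀ k, MeasurableSet {x | k ∈ S x}) : Measurable fun x => upperDensity (S x) :=
  Measurable.limsup fun n =>
    ((measurable_from_top (f := fun m : ℕ => (m : ℝ≥0∞))).comp
      (measurable_boxCount hS n)).div_const _

lemma measurableSet_cell_eq_true (k : Grid d) : MeasurableSet {b : Config d Bool | b k = true} :=
  (measurableSet_singleton true).preimage (measurable_pi_apply k)

lemma measurableSet_nearlyAttained (M : ℕ) : MeasurableSet (nearlyAttained d M) := by
  have : nearlyAttained d M = ⋃ n ∈ Finset.Iic M, {b : Config d Bool |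
      upperDensity {l | b l = true} * (box d n).card ≤ 2 * boxCount n {l | b l = true}} := by
    ext b; simp [nearlyAttained]
  rw [this]
  refine Finset.measurableSet_biUnion _ fun n _ => ?_
  refine measurableSet_le ?_ ?_
  · exact (measurable_upperDensity measurableSet_cell_eq_true).mul_const _
  · exact ((measurable_from_top (f := fun m : ℕ => (m : ℝ≥0∞))).comp
      (measurable_boxCount measurableSet_cell_eq_true n)).const_mul _

lemma measure_cell_eq_true {ν : Measure (Config d Bool)} (hν : ν ∈ invariantMeasures d Bool)
    (k : Grid d) : ν {b | b k = true} = ν {b | b 0 = true} := by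
  conv_rhs => rw [← hν.2 k, Measure.map_apply (measurable_shift k) (measurableSet_cell_eq_true 0)]
  congr 1
  ext b
  simp

lemma lintegral_boxCount {ν : Measure (Config d Bool)} (hν : ν ∈ invariantMeasures d Bool)
    (n : ℕ) : ∫⁻ b, (boxCount n {l | b l = true} : ℝ≥0∞) ∂ν =
      (box d n).card * ν {b | b 0 = true} := by
  classical
  have : ∀ b : Config d Bool, (boxCount n {l | b l = true} : ℝ≥0∞) =
      ∑ k ∈ box d n, {b : Config d Bool | b k = true}.indicator 1 b := by
    intro b
    rw [boxCount, Finset.card_filter, Nat.cast_sum]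
    refine Finset.sum_congr rfl fun k _ => ?_
    simp [Set.indicator_apply]
  simp_rw [this]
  rw [lintegral_finsetSum]
  · simp_rw [lintegral_indicator_one (measurableSet_cell_eq_true _), measure_cell_eq_true hν]
    simp
  · exact fun k _ => measurable_one.indicator (measurableSet_cell_eq_true k)

/-- The mean upper density of a noise is at most a constant times its density. -/
theorem lintegral_upperDensity_le {ν : Measure (Config d Bool)}
    (hν : ν ∈ invariantMeasures d Bool) :
    ∫⁻ b, upperDensity {l | b l = true} ∂ν ≤ 2 * 2 ^ (4 * d) * ν {b | b 0 = true} := by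
  classical
  set D : Config d Bool → ℝ≥0∞ := fun b => upperDensity {l | b l = true} with hD
  have hDm : Measurable D := measurable_upperDensity measurableSet_cell_eq_true
  -- The sets `nearlyAttained d M` increase to the whole space, so by monotone convergence it is
  -- enough to bound each truncation uniformly in `M`.
  have hsup : D = fun b => ⨆ M, (nearlyAttained d M).indicator D b := by
    funext b
    obtain ⟨M, hM⟩ := exists_mem_nearlyAttained b
    refine le_antisymm ?_ (iSup_le fun M => Set.indicator_le_self _ _ _)
    exact le_iSup_of_le M (by rw [Set.indicator_of_mem hM])
  rw [hsup, lintegral_iSup (fun M => hDm.indicator (measurableSet_nearlyAttained M))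
    (fun M M' h b => Set.indicator_le_indicator_of_subset (nearlyAttained_mono h)
      (fun _ => zero_le) b)]
  refine iSup_le fun M => ?_
  set g := (nearlyAttained d M).indicator D with hg
  have hgm : Measurable g := hDm.indicator (measurableSet_nearlyAttained M)
  have hinv : ∀ k, ∫⁻ b, g (shift k b) ∂ν = ∫⁻ b, g b ∂ν := fun k => by
    conv_rhs => rw [← hν.2 k, lintegral_map hgm (measurable_shift k)]
  -- By invariance the integral of `g` is averaged over the shifts in `B_M`. The third factor `2 ^
  -- d` passes from `D (shift k b)` to `D b`; a fourth appears below when `B_(2M)` is compared with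
  -- `B_M`.
  have hpt : ∀ b, ∑ k ∈ box d M, g (shift k b) ≤
      2 * 2 ^ d * 2 ^ d * 2 ^ d * boxCount (2 * M) {l | b l = true} := by
    intro b
    set T := (box d M).filter (fun k => shift k b ∈ nearlyAttained d M)
    calc ∑ k ∈ box d M, g (shift k b) = ∑ k ∈ T, D (shift k b) := by
          rw [Finset.sum_filter]
          rfl
      _ ≤ ∑ k ∈ T, 2 ^ d * D b := Finset.sum_le_sum fun k _ => upperDensity_shift_le k b
      _ = 2 ^ d * (T.card * D b) := by rw [Finset.sum_const, nsmul_eq_mul]; ring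
      _ ≤ 2 ^ d * (2 * 2 ^ d * 2 ^ d * boxCount (2 * M) {l | b l = true}) := by
          gcongr 2 ^ d * ?_
          exact card_mul_upperDensity_le M b T (Finset.filter_subset _ _)
            fun k hk => (Finset.mem_filter.1 hk).2
      _ = _ := by ring
  have hint : (box d M).card * ∫⁻ b, g b ∂ν ≤
      (box d M).card * (2 * 2 ^ (4 * d) * ν {b | b 0 = true}) := by
    calc (box d M).card * ∫⁻ b, g b ∂ν = ∫⁻ b, ∑ k ∈ box d M, g (shift k b) ∂ν := by
          rw [lintegral_finsetSum (f := fun k b => g (shift k b)) _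
            fun k _ => hgm.comp (measurable_shift k)]
          simp_rw [hinv]
          simp
      _ ≤ ∫⁻ b, 2 * 2 ^ d * 2 ^ d * 2 ^ d * boxCount (2 * M) {l | b l = true} ∂ν :=
          lintegral_mono hpt
      _ = 2 * 2 ^ d * 2 ^ d * 2 ^ d * ((box d (2 * M)).card * ν {b | b 0 = true}) := by
          rw [lintegral_const_mul, lintegral_boxCount hν]
          exact (measurable_from_top (f := fun m : ℕ => (m : ℝ≥0∞))).comp
            (measurable_boxCount measurableSet_cell_eq_true _)
      _ ≤ 2 * 2 ^ d * 2 ^ d * 2 ^ d *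
            (((2 ^ d * (box d M).card : ℕ) : ℝ≥0∞) * ν {b | b 0 = true}) := by
          gcongr
          exact card_box_two_mul_le M
      _ = _ := by push_cast; ring
  exact (ENNReal.mul_le_mul_iff_right (card_box_ne_zero M) (ENNReal.natCast_ne_top _)).1 hint

end Maximal

/-! ### Block codes -/

section BlockCodes

variable {d : ℕ} {A B : Type*}

/-- The block code of radius `r` with local rule `ψ`. -/
def blockCode (r : ℕ) (ψ : (box d r → A) → B) (x : Config d A) : Config d B :=
  fun k => ψ fun i => x (k + i)

lemma blockCode_congr {r : ℕ} (ψ : (box d r → A) → B) {x y : Config d A} {k : Grid d}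
    (h : ∀ l ∈ box d r, x (k + l) = y (k + l)) : blockCode r ψ x k = blockCode r ψ y k := by
  unfold blockCode
  congr 1
  funext i
  exact h i i.2

lemma blockCode_shift {r : ℕ} (ψ : (box d r → A) → B) (k : Grid d) (x : Config d A) :
    blockCode r ψ (shift k x) = shift k (blockCode r ψ x) := by
  funext l
  simp [blockCode, add_assoc]

lemma measurable_blockCode [Finite A] [MeasurableSpace A] [DiscreteMeasurableSpace A]
    [MeasurableSpace B] {r : ℕ} (ψ : (box d r → A) → B) : Measurable (blockCode r ψ) :=
  measurable_pi_lambda _ fun k => (Measurable.of_discrete (f := ψ)).comp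
    (measurable_pi_lambda _ fun i => measurable_pi_apply (k + i))

/-- A continuous map to a discrete space is constant on a cylinder around each point. Having a
common radius passes to finite unions, so compactness gives one for the whole of `X`. -/
lemma exists_uniform_radius [Finite A] [TopologicalSpace A] [DiscreteTopology A]
    [TopologicalSpace B] [DiscreteTopology B] {X : Set (Config d A)} (hX : IsClosed X)
    {f : X → B} (hf : Continuous f) :
    ∃ r, ∀ x y : X, (∀ l ∈ box d r, x.1 l = y.1 l) → f x = f y := by
  have hc : CompactSpace X := isCompact_iff_compactSpace.1 hX.isCompact
  have := isCompact_univ.induction_on (X := X)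
    (p := fun s => ∃ r, ∀ x ∈ s, ∀ y : X, (∀ l ∈ box d r, x.1 l = y.1 l) → f x = f y)
    ⟨0, by simp⟩ (fun s t hst ⟨r, hr⟩ => ⟨r, fun x hx => hr x (hst hx)⟩)
    (fun s t ⟨r, hr⟩ ⟨r', hr'⟩ => ⟨max r r', fun x hx y hxy => hx.elim
      (fun hx => hr x hx y fun l hl => hxy l (box_mono (le_max_left _ _) hl))
      (fun hx => hr' x hx y fun l hl => hxy l (box_mono (le_max_right _ _) hl))⟩) ?_
  · obtain ⟨r, hr⟩ := this
    exact ⟨r, fun x y h => hr x (Set.mem_univ x) y h⟩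
  intro x _
  have hU : f ⁻¹' {f x} ∈ 𝓝 x := hf.continuousAt (by simp)
  rw [mem_nhds_subtype] at hU
  obtain ⟨u, hu, hux⟩ := hU
  rw [nhds_pi, Filter.mem_pi] at hu
  obtain ⟨I, hI, t, ht, htu⟩ := hu
  obtain ⟨r, hr⟩ := exists_subset_box hI.toFinset
  have key : ∀ y : X, (∀ l ∈ box d r, x.1 l = y.1 l) → f y = f x := by
    intro y hy
    refine hux (htu fun i hi => ?_)
    rw [← hy i (hr (hI.mem_toFinset.2 hi))]
    exact mem_of_mem_nhds (ht i)
  refine ⟨{y | ∀ l ∈ box d r, x.1 l = y.1 l}, mem_nhdsWithin_of_mem_nhds ?_, r,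
    fun y hy z hyz => ?_⟩
  · have : {y : X | ∀ l ∈ box d r, x.1 l = y.1 l} = Subtype.val ⁻¹' cylinder (box d r) x.1 := by
      ext y; simp [SymbolicDynamics.FullShift.cylinder, eq_comm]
    rw [this]
    exact ((isOpen_cylinder _ _).preimage continuous_subtype_val).mem_nhds (by simp [SymbolicDynamics.FullShift.cylinder])
  · rw [key y hy, key z fun l hl => (hy l hl).trans (hyz l hl)]

/-- The Curtis-Hedlund-Lyndon theorem: a morphism of subshifts is a block code. -/
lemma IsMorphism.exists_blockCode [Inhabited A] [Inhabited B] [Finite A] [TopologicalSpace A]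
    [DiscreteTopology A] [TopologicalSpace B] [DiscreteTopology B] {F : Set (Pattern A (Grid d))}
    {G : Set (Pattern B (Grid d))} {θ : forbidden F → forbidden G} (hθ : IsMorphism F G θ) :
    ∃ (r : ℕ) (ψ : (box d r → A) → B), ∀ x : forbidden F, blockCode r ψ x.1 = (θ x).1 := by
  classical
  obtain ⟨r, hr⟩ := exists_uniform_radius (isClosed_forbidden F)
    (f := fun x => (θ x).1 0) ((continuous_apply 0).comp (continuous_subtype_val.comp hθ.continuous))
  -- The rule extends the window to any point of the subshift and reads the image at the origin; by
  -- `hr` the extension chosen is irrelevant. Windows that do not extend receive the default letter.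
  refine ⟨r, fun p => if h : ∃ x : forbidden F, ∀ i : box d r, x.1 i = p i then
    (θ h.choose).1 0 else default, fun x => ?_⟩
  funext k
  have h : ∃ y : forbidden F, ∀ i : box d r, y.1 i = x.1 (k + i) :=
    ⟨⟨shift k x.1, Pattern.mapsTo_shift_forbidden F k x.2⟩, fun i => rfl⟩
  have h2 := hr h.choose ⟨shift k x.1, Pattern.mapsTo_shift_forbidden F k x.2⟩
    fun l hl => h.choose_spec ⟨l, hl⟩
  simp only [blockCode, dif_pos h]
  rw [h2, hθ.commutes]
  simp

/-- The inverse of a bijective morphism is a morphism. -/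
lemma IsMorphism.symm_of_bijective [Inhabited A] [Inhabited B] [Finite A] [TopologicalSpace A]
    [DiscreteTopology A] [TopologicalSpace B] [DiscreteTopology B] {F : Set (Pattern A (Grid d))}
    {G : Set (Pattern B (Grid d))} {θ : forbidden F → forbidden G} (hθ : IsMorphism F G θ)
    (hb : Function.Bijective θ) : IsMorphism G F (Equiv.ofBijective θ hb).symm := by
  have hc : CompactSpace (forbidden F) :=
    isCompact_iff_compactSpace.1 (isClosed_forbidden F).isCompact
  refine ⟨Continuous.continuous_symm_of_equiv_compact_to_t2 (f := Equiv.ofBijective θ hb)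
    hθ.continuous, fun k y => ?_⟩
  obtain ⟨x, rfl⟩ := (Equiv.ofBijective θ hb).surjective y
  rw [Equiv.symm_apply_apply]
  refine congrArg Subtype.val (((Equiv.ofBijective θ hb).symm_apply_eq).2 (Subtype.ext ?_) :
    _ = (⟨shift k x.1, Pattern.mapsTo_shift_forbidden F k x.2⟩ : forbidden F))
  exact (hθ.commutes k x).symm

end BlockCodes

/-! ### Local and global admissibility -/

section Admissible

variable {d : ℕ} {A : Type*} [Inhabited A]

/-- A configuration without forbidden patterns in a large box coincides on a small box with an
element of the subshift. -/
lemma exists_radius_admissible [Finite A] [TopologicalSpace A] [DiscreteTopology A]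
    (G : Set (Pattern A (Grid d))) (m : ℕ) :
    ∃ n, ∀ y : Config d A, (∀ w ∈ G, ∀ g, (∀ h ∈ w.support, g + h ∈ box d n) →
      ¬ w.occursInAt y g) → ∃ y' ∈ forbidden G, ∀ l ∈ box d m, y l = y' l := by
  set K : ℕ → Set (Config d A) := fun n => {y | ∀ w ∈ G, ∀ g,
    (∀ h ∈ w.support, g + h ∈ box d n) → ¬ w.occursInAt y g} with hK
  set U : Set (Config d A) := ⋃ y' ∈ forbidden G, cylinder (box d m) y' with hU
  have hUo : IsOpen U := isOpen_biUnion fun y _ => isOpen_cylinder _ _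
  have hKc : ∀ n, IsClosed (K n) := fun n => by
    simp only [hK, Set.ofPred_forall]
    refine isClosed_iInter fun w => isClosed_iInter fun _ => isClosed_iInter fun g =>
      isClosed_iInter fun _ => (isOpen_occursInAt w g).isClosed_compl
  have hanti : Antitone K := fun n n' hn y hy w hw g h =>
    hy w hw g fun i hi => box_mono hn (h i hi)
  -- The compact sets `K n` decrease to `forbidden G`, since any occurrence of a pattern fits in
  -- some box. Hence one of them already lies in the open neighbourhood `U`.
  obtain ⟨n, hn⟩ := exists_subset_nhds_of_isCompact' (U := U) hanti.directed_ge
    (fun n => (hKc n).isCompact) hKc (fun y hy => by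
      refine hUo.mem_nhds (Set.mem_biUnion (x := y) (fun w hw g => ?_) fun _ _ => rfl)
      classical
      obtain ⟨n, hn⟩ := exists_subset_box (w.support.image (g + ·))
      exact Set.mem_iInter.1 hy n w hw g fun h hh => hn (Finset.mem_image_of_mem _ hh))
  refine ⟨n, fun y hy => ?_⟩
  obtain ⟨y', hy', h⟩ := Set.mem_iUnion₂.1 (hn hy)
  exact ⟨y', hy', h⟩

/-- A noisy configuration that is clear on a large box coincides on a small box with an element of
the subshift. -/
lemma exists_radius_clear [Finite A] [TopologicalSpace A] [DiscreteTopology A]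
    (G : Set (Pattern A (Grid d))) (m : ℕ) :
    ∃ n, ∀ z ∈ forbidden (clearPatterns G), ∀ k, (∀ l ∈ box d n, (z (k + l)).2 = false) →
      ∃ y ∈ forbidden G, ∀ l ∈ box d m, (z (k + l)).1 = y (k + l) := by
  obtain ⟨n, hn⟩ := exists_radius_admissible G m
  refine ⟨n, fun z hz k hk => ?_⟩
  obtain ⟨y, hy, h⟩ := hn (shift k (letterMap Prod.fst z)) fun w hw g hg hocc =>
    hz (clearPattern w) ⟨w, hw, rfl⟩ (k + g) fun h hh => by
      refine Prod.ext ?_ ?_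
      · have := hocc h hh
        simpa [letterMap, clearPattern, add_assoc] using this
      · rw [add_assoc]; exact hk _ (hg h hh)
  refine ⟨shift (-k) y, Pattern.mapsTo_shift_forbidden G (-k) hy, fun l hl => ?_⟩
  have := h l hl
  simpa [letterMap] using this

lemma measurableSet_forbidden [MeasurableSpace A] [MeasurableSingletonClass A]
    {F : Set (Pattern A (Grid d))} (hF : F.Countable) : MeasurableSet (forbidden F) := by
  have : forbidden F = ⋂ p ∈ F, ⋂ g : Grid d, (⋂ h ∈ p.support, {x | x (g + h) = p.config h})ᶜ := by
    ext x
    simp [forbidden, Pattern.occursInAt]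
  rw [this]
  refine MeasurableSet.biInter hF fun p _ => MeasurableSet.iInter fun g => MeasurableSet.compl ?_
  exact Finset.measurableSet_biInter _ fun h _ =>
    (measurableSet_singleton _).preimage (measurable_pi_apply (g + h))

end Admissible

/-! ### Thickening -/

section Thickening

variable {d : ℕ}

lemma thicken_eq_false {n : ℕ} {b : Config d Bool} {c : Grid d} :
    thicken n b c = false ↔ ∀ k ∈ box d n, b (c + k) = false :=
  Finset.sup_eq_bot_iff _ _

lemma thicken_eq_true {n : ℕ} {b : Config d Bool} {c : Grid d} :
    thicken n b c = true ↔ ∃ k ∈ box d n, b (c + k) = true := by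
  rw [← not_iff_not, Bool.not_eq_true, thicken_eq_false]
  push Not
  simp

lemma thicken_shift (n : ℕ) (k : Grid d) (b : Config d Bool) :
    thicken n (shift k b) = shift k (thicken n b) := by
  funext c
  simp [thicken, add_assoc]

lemma measurable_thicken (n : ℕ) : Measurable (thicken n : Config d Bool → Config d Bool) := by
  refine measurable_pi_lambda _ fun c => measurable_to_bool ?_
  have : (fun b : Config d Bool => thicken n b c) ⁻¹' {true} =
      ⋃ k ∈ box d n, {b | b (c + k) = true} := by
    ext b; simp [thicken_eq_true]
  rw [this]
  exact Finset.measurableSet_biUnion _ fun k _ => measurableSet_cell_eq_true _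

lemma measure_thicken_le {ν : Measure (Config d Bool)} (hν : ν ∈ invariantMeasures d Bool)
    (n : ℕ) : ν.map (thicken n) {b | b 0 = true} ≤ (box d n).card * ν {b | b 0 = true} := by
  rw [Measure.map_apply (measurable_thicken n) (measurableSet_cell_eq_true 0)]
  have : thicken n ⁻¹' {b : Config d Bool | b 0 = true} = ⋃ k ∈ box d n, {b | b k = true} := by
    ext b; simp [thicken_eq_true]
  rw [this]
  refine (measure_biUnion_finset_le _ _).trans (le_of_eq ?_)
  simp_rw [measure_cell_eq_true hν]
  simp

/-- The image of an invariant measure by a map that commutes with the shifts is invariant. -/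
lemma map_mem_invariantMeasures {A B : Type*} [MeasurableSpace A] [MeasurableSpace B]
    {μ : Measure (Config d A)} (hμ : μ ∈ invariantMeasures d A) {Φ : Config d A → Config d B}
    (hΦ : Measurable Φ) (hs : ∀ k x, Φ (shift k x) = shift k (Φ x)) :
    μ.map Φ ∈ invariantMeasures d B := by
  have := hμ.1
  refine ⟨Measure.isProbabilityMeasure_map hΦ.aemeasurable, fun k => ?_⟩
  have h : shift k ∘ Φ = Φ ∘ shift k := funext fun x => (hs k x).symm
  rw [Measure.map_map (measurable_shift k) hΦ, h, ← Measure.map_map hΦ (measurable_shift k),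
    hμ.2 k]

lemma closedUnderThickening_invariantMeasures :
    ClosedUnderThickening (invariantMeasures d Bool) := fun n _ hν =>
  map_mem_invariantMeasures hν (measurable_thicken n) (thicken_shift n)

end Thickening

/-! ### Gluing of couplings -/

section Gluing

open ProbabilityTheory

variable {X Y Z : Type*} [MeasurableSpace X] [MeasurableSpace Y] [MeasurableSpace Z]
  [StandardBorelSpace Z] [Nonempty Z]

/-- The disintegration of an invariant measure on a product is equivariant. -/
lemma ae_condKernel_equivariant {κ : Measure (X × Z)} [IsFiniteMeasure κ] {S S' : X → X} {T : Z → Z}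
    (hS : Measurable S) (hS' : Measurable S') (hT : Measurable T) (hinv : ∀ x, S' (S x) = x)
    (hκ : κ.map (Prod.map S T) = κ) :
    ∀ᵐ x ∂κ.fst, (κ.condKernel x).map T = κ.condKernel (S x) := by
  have hfst : κ.fst.map S = κ.fst := by
    conv_rhs => rw [← hκ]
    rw [Measure.fst, Measure.fst, Measure.map_map hS measurable_fst,
      Measure.map_map measurable_fst (hS.prodMap hT)]
    rfl
  -- The transported kernel sends `S x` to the image of `κ.condKernel x` under `T`. Invariance makes
  -- it a second disintegration of `κ`, and almost sure uniqueness concludes.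
  set K : Kernel X Z := (κ.condKernel.map T).comap S' hS' with hK
  have hKS : ∀ x, K (S x) = (κ.condKernel x).map T := fun x => by
    rw [hK, Kernel.comap_apply, hinv, Kernel.map_apply _ hT]
  have : IsFiniteKernel K := by rw [hK]; infer_instance
  have heq : κ = κ.fst ⊗ₘ K := by
    refine Measure.ext_of_lintegral _ fun f hf => ?_
    have hfST : Measurable fun p : X × Z => f (Prod.map S T p) := hf.comp (hS.prodMap hT)
    rw [Measure.lintegral_compProd hf]
    calc ∫⁻ p, f p ∂κ = ∫⁻ p, f (Prod.map S T p) ∂κ := by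
          conv_lhs => rw [← hκ, lintegral_map hf (hS.prodMap hT)]
      _ = ∫⁻ p, f (Prod.map S T p) ∂(κ.fst ⊗ₘ κ.condKernel) := by
          rw [κ.disintegrate]
      _ = ∫⁻ x, ∫⁻ z, f (S x, T z) ∂κ.condKernel x ∂κ.fst := Measure.lintegral_compProd hfST
      _ = ∫⁻ x, ∫⁻ z, f (S x, z) ∂K (S x) ∂κ.fst := by
          refine lintegral_congr fun x => ?_
          rw [hKS, lintegral_map (f := fun z => f (S x, z)) (hf.comp measurable_prodMk_left) hT]
      _ = ∫⁻ x, ∫⁻ z, f (x, z) ∂K x ∂(κ.fst.map S) := by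
          rw [lintegral_map (Measurable.lintegral_kernel_prod_right' hf) hS]
      _ = _ := by rw [hfst]
  have hae := eq_condKernel_of_measure_eq_compProd K heq
  rw [← hfst] at hae
  filter_upwards [ae_of_ae_map hS.aemeasurable hae] with x hx
  rw [← hKS, hx]

/-- The gluing of a measure `μ` with a measure `κ` over a map `Φ` that sends `μ` to the first
marginal of `κ`. -/
noncomputable def glue (μ : Measure Y) (κ : Measure (X × Z)) [IsFiniteMeasure κ] {Φ : Y → X}
    (hΦ : Measurable Φ) : Measure (Y × Z) :=
  μ ⊗ₘ κ.condKernel.comap Φ hΦ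

variable {μ : Measure Y} {κ : Measure (X × Z)} [IsProbabilityMeasure μ] [IsFiniteMeasure κ]
  {Φ : Y → X} (hΦ : Measurable Φ)

instance : IsProbabilityMeasure (glue μ κ hΦ) := by unfold glue; infer_instance

lemma map_fst_glue : (glue μ κ hΦ).map Prod.fst = μ := Measure.fst_compProd _ _

lemma lintegral_glue {f : Y × Z → ℝ≥0∞} (hf : Measurable f) :
    ∫⁻ p, f p ∂glue μ κ hΦ = ∫⁻ y, ∫⁻ z, f (y, z) ∂κ.condKernel (Φ y) ∂μ :=
  Measure.lintegral_compProd hf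

lemma map_glue (hfst : μ.map Φ = κ.fst) : (glue μ κ hΦ).map (Prod.map Φ id) = κ := by
  refine Measure.ext_of_lintegral _ fun f hf => ?_
  have hm : Measurable (Prod.map Φ (id : Z → Z)) := hΦ.prodMap measurable_id
  rw [lintegral_map hf hm, lintegral_glue hΦ (f := fun p => f (Prod.map Φ id p)) (hf.comp hm)]
  conv_rhs => rw [← κ.disintegrate κ.condKernel, Measure.lintegral_compProd hf, ← hfst,
    lintegral_map (Measurable.lintegral_kernel_prod_right' hf) hΦ]
  rfl

/-- Invariance of `μ` moves the base point from `y` to `R y`, and equivariance of the disintegration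
moves the fibre measure accordingly. This is what makes the lifted coupling shift-invariant. -/
lemma map_prodMap_glue (hfst : μ.map Φ = κ.fst) {R : Y → Y} {S S' : X → X} {T : Z → Z}
    (hR : Measurable R) (hS : Measurable S) (hS' : Measurable S') (hT : Measurable T)
    (hinv : ∀ x, S' (S x) = x) (hκ : κ.map (Prod.map S T) = κ) (hμ : μ.map R = μ)
    (hcomm : ∀ y, Φ (R y) = S (Φ y)) :
    (glue μ κ hΦ).map (Prod.map R T) = glue μ κ hΦ := by
  have hae := ae_condKernel_equivariant hS hS' hT hinv hκ
  rw [← hfst] at hae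
  refine Measure.ext_of_lintegral _ fun f hf => ?_
  have hm : Measurable (Prod.map R T) := hR.prodMap hT
  rw [lintegral_map hf hm, lintegral_glue hΦ (f := fun p => f (Prod.map R T p)) (hf.comp hm),
    lintegral_glue hΦ hf]
  conv_rhs => rw [← hμ]
  rw [lintegral_map (f := fun y => ∫⁻ z, f (y, z) ∂κ.condKernel (Φ y))
    (Measurable.lintegral_kernel_prod_right' (κ := κ.condKernel.comap Φ hΦ) hf) hR]
  refine lintegral_congr_ae ?_
  filter_upwards [ae_of_ae_map hΦ.aemeasurable hae] with y hy
  rw [hcomm, ← hy, lintegral_map (f := fun z => f (R y, z)) (hf.comp measurable_prodMk_left) hT]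
  rfl

end Gluing

/-! ### Transfer of noisy measures along a conjugacy -/

section Transfer

variable {d : ℕ} {A B : Type*}

/-- A block code on the letters, and a thickening on the noise. -/
noncomputable def noisyCode (s : ℕ) (χ : (box d s → B) → A) (n : ℕ) (z : Config d (B × Bool)) :
    Config d (A × Bool) :=
  fun k => (blockCode s χ (letterMap Prod.fst z) k, thicken n (letterMap Prod.snd z) k)

lemma letterMap_shift {A B : Type*} (p : A → B) (k : Grid d) (x : Config d A) :
    letterMap p (shift k x) = shift k (letterMap p x) := rfl

lemma noisyCode_shift (s : ℕ) (χ : (box d s → B) → A) (n : ℕ) (k : Grid d)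
    (z : Config d (B × Bool)) : noisyCode s χ n (shift k z) = shift k (noisyCode s χ n z) := by
  funext l
  simp only [noisyCode, letterMap_shift, blockCode_shift, thicken_shift, shift_apply]

lemma measurable_noisyCode [Finite B] [MeasurableSpace B] [DiscreteMeasurableSpace B]
    [MeasurableSpace A] (s : ℕ) (χ : (box d s → B) → A) (n : ℕ) :
    Measurable (noisyCode s χ n) :=
  measurable_pi_lambda _ fun k =>
    ((measurable_pi_apply k).comp ((measurable_blockCode χ).comp
      (measurable_letterMap measurable_fst))).prodMk
    ((measurable_pi_apply k).comp ((measurable_thicken n).comp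
      (measurable_letterMap measurable_snd)))

lemma measurable_hammingBesicovitch [Finite B] [MeasurableSpace B] [DiscreteMeasurableSpace B]
    {X : Type*} [MeasurableSpace X] {f g : X → Config d B}
    (hf : Measurable f) (hg : Measurable g) :
    Measurable fun x => hammingBesicovitch (f x) (g x) := by
  simp_rw [hammingBesicovitch_eq]
  refine measurable_upperDensity fun k => ?_
  exact (measurableSet_eq_fun ((measurable_pi_apply k).comp hf)
    ((measurable_pi_apply k).comp hg)).compl

/-- `χ` and `ψ` are the local rules of mutually inverse codes between two subshifts, and `n` is a
radius such that the two codes can be applied to noisy configurations that are clear on a box of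
radius `n`. -/
structure IsNoisyInverse [Inhabited A] [Inhabited B] (F : Set (Pattern A (Grid d)))
    (G : Set (Pattern B (Grid d))) {r s : ℕ} (ψ : (box d r → A) → B) (χ : (box d s → B) → A)
    (n : ℕ) : Prop where
  mapsTo : ∀ x ∈ forbidden F, blockCode r ψ x ∈ forbidden G
  mapsTo_clear : ∀ z ∈ forbidden (clearPatterns G), noisyCode s χ n z ∈ forbidden (clearPatterns F)
  rightInv : ∀ z ∈ forbidden (clearPatterns G), ∀ k, thicken n (letterMap Prod.snd z) k = false →
    blockCode r ψ (blockCode s χ (letterMap Prod.fst z)) k = (z k).1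

lemma exists_isNoisyInverse [Inhabited A] [Inhabited B] [Finite B] [TopologicalSpace B]
    [DiscreteTopology B] {F : Set (Pattern A (Grid d))} {G : Set (Pattern B (Grid d))}
    (hF : F.Finite) (hne : (forbidden F).Nonempty) {r s : ℕ} {ψ : (box d r → A) → B}
    {χ : (box d s → B) → A} (hψ : ∀ x ∈ forbidden F, blockCode r ψ x ∈ forbidden G)
    (hχ : ∀ y ∈ forbidden G, blockCode s χ y ∈ forbidden F)
    (hinv : ∀ y ∈ forbidden G, blockCode r ψ (blockCode s χ y) = y) :
    ∃ n, IsNoisyInverse F G ψ χ n := by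
  classical
  obtain ⟨t, ht⟩ := exists_subset_box (hF.toFinset.biUnion fun w => w.support)
  have ht' : ∀ w ∈ F, ∀ h ∈ w.support, h ∈ box d t := fun w hw h hh =>
    ht (Finset.mem_biUnion.2 ⟨w, hF.mem_toFinset.2 hw, hh⟩)
  -- Windows of `F` lie in `B_t`, so two of their cells differ by an element of `B_(2t)`; then `s`
  -- is the reach of `χ`. For the inverse property, `ψ ∘ χ` has reach `s + r`.
  obtain ⟨n, hn⟩ := exists_radius_clear G (t + t + s + r)
  refine ⟨n, hψ, ?_, ?_⟩
  · rintro z hz _ ⟨w, hw, rfl⟩ g hocc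
    -- A pattern with empty window occurs everywhere, which would make the subshift of `F` empty. A
    -- cell of the window is needed as the centre of a clear box.
    have hw0 : w.support.Nonempty := by
      rw [Finset.nonempty_iff_ne_empty]
      intro h0
      obtain ⟨x, hx⟩ := hne
      exact hx w hw 0 fun h hh => by simp [h0] at hh
    obtain ⟨c, hc⟩ := hw0
    obtain ⟨y, hy, hyz⟩ := hn z hz (g + c) fun l hl =>
      thicken_eq_false.1 (congrArg Prod.snd (hocc c hc)) l hl
    refine hχ y hy w hw g fun h hh => ?_
    refine Eq.trans ?_ (congrArg Prod.fst (hocc h hh))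
    refine blockCode_congr χ fun l hl => ?_
    have hmem : h - c + l ∈ box d (t + t + s + r) := box_mono (Nat.le_add_right _ _)
      (add_mem_box (sub_mem_box (ht' w hw h hh) (ht' w hw c hc)) hl)
    have := hyz _ hmem
    rw [show g + c + (h - c + l) = g + h + l by abel] at this
    exact this.symm
  · intro z hz k hk
    obtain ⟨y, hy, hyz⟩ := hn z hz k (thicken_eq_false.1 hk)
    have h0 := hyz 0 (zero_mem_box _)
    rw [add_zero] at h0
    rw [h0, ← congrFun (hinv y hy) k]
    refine blockCode_congr ψ fun l hl => blockCode_congr χ fun l' hl' => ?_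
    have := hyz (l + l') (box_mono (by omega) (add_mem_box hl hl'))
    rwa [← add_assoc] at this

variable [Inhabited A] [Inhabited B] {F : Set (Pattern A (Grid d))} {G : Set (Pattern B (Grid d))}
  {r s n : ℕ} {ψ : (box d r → A) → B} {χ : (box d s → B) → A}

/-- If no noise lies within `n` of `k`, the letter of `z` at `k` is recovered by `ψ` from the
`χ`-image; it can differ from that of `ψ x` only if this image differs from `x` within `r` of `k`.
-/
lemma IsNoisyInverse.hammingBesicovitch_le (h : IsNoisyInverse F G ψ χ n)
    {z : Config d (B × Bool)} (hz : z ∈ forbidden (clearPatterns G)) (x : Config d A) :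
    hammingBesicovitch (letterMap Prod.fst z) (blockCode r ψ x) ≤
      (box d n).card * 2 ^ d * upperDensity {k | letterMap Prod.snd z k = true} +
      (box d r).card * 2 ^ d *
        hammingBesicovitch (blockCode s χ (letterMap Prod.fst z)) x := by
  rw [hammingBesicovitch_eq, hammingBesicovitch_eq]
  refine le_trans ?_ (add_le_add (upperDensity_thicken_le _ _) (upperDensity_thicken_le _ _))
  refine le_trans (upperDensity_mono fun k hk => ?_) (upperDensity_union_le _ _)
  by_cases hb : thicken n (letterMap Prod.snd z) k = false
  · refine Or.inr ?_
    by_contra hcon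
    refine hk ((h.rightInv z hz k hb).symm.trans (blockCode_congr ψ fun l hl => ?_))
    by_contra hl'
    exact hcon ⟨l, hl, hl'⟩
  · exact Or.inl (thicken_eq_true.1 (by simpa using hb))

/-- The map `ε ↦ min 1 (c * ε)` of the unit interval. -/
noncomputable def scale (c : ℕ) (ε : unitInterval) : unitInterval :=
  Set.projIcc 0 1 zero_le_one (c * (ε : ℝ))

lemma coe_scale (c : ℕ) (ε : unitInterval) : (scale c ε : ℝ) = min 1 (c * (ε : ℝ)) := by
  rw [scale, Set.coe_projIcc]
  exact max_eq_right (le_min zero_le_one (mul_nonneg c.cast_nonneg ε.2.1))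

variable [Finite B] [MeasurableSpace B] [DiscreteMeasurableSpace B] [MeasurableSpace A]

/-- The noise of the image is exactly the thickened noise: closure under thickening keeps it in `N`,
and a union bound over `B_n` controls its density, capped at `1` as a probability. -/
lemma IsNoisyInverse.map_noisyCode_mem [DiscreteMeasurableSpace A] (h : IsNoisyInverse F G ψ χ n)
    (hF : F.Finite) {N : Set (Measure (Config d Bool))} (hN : ClosedUnderThickening N)
    {ε : unitInterval} {m : Measure (Config d (B × Bool))} (hm : m ∈ noisyMeasuresTilde G N ε) :
    m.map (noisyCode s χ n) ∈ noisyMeasuresTilde F N (scale (box d n).card ε) := by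
  obtain ⟨⟨hinv, hsupp⟩, hmN, hmε⟩ := hm
  have hmeas := measurable_noisyCode s χ n
  have hsnd : (m.map (noisyCode s χ n)).map (letterMap Prod.snd) =
      (m.map (letterMap Prod.snd)).map (thicken n) := by
    rw [Measure.map_map (measurable_letterMap measurable_snd) hmeas,
      Measure.map_map (measurable_thicken n) (measurable_letterMap measurable_snd)]
    rfl
  have hinv2 : (m.map (letterMap Prod.snd)).map (thicken n) ∈ invariantMeasures d Bool :=
    closedUnderThickening_invariantMeasures n _ hmε.1
  refine ⟨⟨map_mem_invariantMeasures hinv hmeas (noisyCode_shift s χ n), ?_⟩, ?_, ?_⟩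
  · refine (ae_map_iff hmeas.aemeasurable
      (measurableSet_forbidden (hF.image clearPattern).countable)).2 ?_
    filter_upwards [hsupp] with z hz using h.mapsTo_clear z hz
  · rw [hsnd]
    exact hN n _ hmN
  · rw [hsnd]
    refine ⟨hinv2, ?_⟩
    have := hinv2.1
    rw [coe_scale, ENNReal.ofReal_min, ENNReal.ofReal_one, ENNReal.ofReal_mul (Nat.cast_nonneg _),
      ENNReal.ofReal_natCast]
    exact le_min prob_le_one ((measure_thicken_le hmε.1 n).trans (by gcongr; exact hmε.2))

/-- A coupling of the image of a noisy measure by `χ` is lifted to a coupling of the noisy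
measure. -/
lemma IsNoisyInverse.besicovitchDistTo_le_of_coupling [Finite A] [DiscreteMeasurableSpace A]
    (h : IsNoisyInverse F G ψ χ n) (hG : G.Finite) {N : Set (Measure (Config d Bool))}
    {ε : unitInterval} {m : Measure (Config d (B × Bool))} (hm : m ∈ noisyMeasuresTilde G N ε)
    {ν : Measure (Config d A)} (hν : ν ∈ sftMeasures F) {κ : Measure (Config d (A × A))}
    (hκ : κ ∈ couplings ((m.map (noisyCode s χ n)).map (letterMap Prod.fst)) ν) :
    besicovitchDistTo (m.map (letterMap Prod.fst)) (sftMeasures G) ≤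
      (box d n).card * 2 ^ d * (2 * 2 ^ (4 * d) * ENNReal.ofReal ε) + (box d r).card * 2 ^ d *
        ∫⁻ z, hammingBesicovitch (letterMap Prod.fst z) (letterMap Prod.snd z) ∂κ := by
  obtain ⟨⟨hinv, hsupp⟩, -, hmε⟩ := hm
  obtain ⟨hκinv, hκfst, hκsnd⟩ := hκ
  have := hinv.1
  have := hκinv.1
  have hψm : Measurable (blockCode r ψ) := measurable_blockCode ψ
  have hlf : Measurable (letterMap Prod.fst : Config d (A × A) → Config d A) :=
    measurable_letterMap measurable_fst
  have hls : Measurable (letterMap Prod.snd : Config d (A × A) → Config d A) :=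
    measurable_letterMap measurable_snd
  have hbf : Measurable (letterMap Prod.fst : Config d (B × Bool) → Config d B) :=
    measurable_letterMap measurable_fst
  have hbs : Measurable (letterMap Prod.snd : Config d (B × Bool) → Config d Bool) :=
    measurable_letterMap measurable_snd
  set Φ : Config d (B × Bool) → Config d A := fun z => blockCode s χ (letterMap Prod.fst z) with hΦd
  have hΦ : Measurable Φ := (measurable_blockCode χ).comp hbf
  set κ' : Measure (Config d A × Config d A) :=
    κ.map (fun z => (letterMap Prod.fst z, letterMap Prod.snd z)) with hκ'
  have hpm : Measurable fun z : Config d (A × A) => (letterMap Prod.fst z, letterMap Prod.snd z) :=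
    hlf.prodMk hls
  have : IsProbabilityMeasure κ' := Measure.isProbabilityMeasure_map hpm.aemeasurable
  have hfst : m.map Φ = κ'.fst := by
    rw [Measure.fst, hκ', Measure.map_map measurable_fst hpm]
    refine Eq.trans ?_ hκfst.symm
    rw [Measure.map_map (measurable_letterMap measurable_fst) (measurable_noisyCode s χ n)]
    rfl
  -- The marginals of `κ'` are `Φ_* m` and `ν`; gluing over `Φ` replaces the first by `m`, keeping
  -- the letters and the noise that `Φ` forgets.
  set ρ := glue m κ' hΦ with hρ
  have hρfst : ρ.map Prod.fst = m := map_fst_glue hΦ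
  have hρsnd : ρ.map Prod.snd = ν := by
    have : (Prod.snd : Config d (B × Bool) × Config d A → Config d A) =
      Prod.snd ∘ Prod.map Φ id := rfl
    rw [this, ← Measure.map_map measurable_snd (hΦ.prodMap measurable_id), hρ,
      map_glue hΦ hfst, hκ', Measure.map_map measurable_snd hpm, ← hκsnd]
    rfl
  have hρinv : ∀ k, ρ.map (Prod.map (shift k) (shift k)) = ρ := fun k => by
    refine map_prodMap_glue hΦ hfst (measurable_shift k) (measurable_shift k)
      (measurable_shift (-k)) (measurable_shift k)
      (fun x => by rw [← shift_add, add_neg_cancel, shift_zero]) ?_ (hinv.2 k)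
      (fun z => blockCode_shift χ k (letterMap Prod.fst z))
    rw [hκ', Measure.map_map ((measurable_shift k).prodMap (measurable_shift k)) hpm]
    conv_rhs => rw [← hκinv.2 k, Measure.map_map hpm (measurable_shift k)]
    rfl
  -- Forgetting the noise on one side and coding by `ψ` on the other turns `ρ` into a coupling over
  -- the alphabet of `G`.
  set Q : Config d (B × Bool) × Config d A → Config d (B × B) :=
    fun p k => ((p.1 k).1, blockCode r ψ p.2 k) with hQ
  have hQm : Measurable Q := measurable_pi_lambda _ fun k =>
    (measurable_fst.comp ((measurable_pi_apply k).comp measurable_fst)).prodMk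
      ((measurable_pi_apply k).comp (hψm.comp measurable_snd))
  have hcoup : ρ.map Q ∈ couplings (m.map (letterMap Prod.fst)) (ν.map (blockCode r ψ)) := by
    refine ⟨⟨Measure.isProbabilityMeasure_map hQm.aemeasurable, fun k => ?_⟩, ?_, ?_⟩
    · rw [Measure.map_map (measurable_shift k) hQm]
      conv_rhs => rw [← hρinv k,
        Measure.map_map hQm ((measurable_shift k).prodMap (measurable_shift k))]
      congr 1
      funext p l
      simp only [hQ, Function.comp_apply, Prod.map, blockCode_shift, shift_apply]
    · rw [Measure.map_map (measurable_letterMap measurable_fst) hQm]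
      conv_rhs => rw [← hρfst, Measure.map_map hbf measurable_fst]
      rfl
    · rw [Measure.map_map (measurable_letterMap measurable_snd) hQm, ← hρsnd,
        Measure.map_map hψm measurable_snd]
      rfl
  have hνG : ν.map (blockCode r ψ) ∈ sftMeasures G := by
    refine ⟨map_mem_invariantMeasures hν.1 hψm (blockCode_shift ψ), ?_⟩
    refine (ae_map_iff hψm.aemeasurable (measurableSet_forbidden hG.countable)).2 ?_
    filter_upwards [hν.2] with x hx using h.mapsTo x hx
  have hρsupp : ∀ᵐ p ∂ρ, p.1 ∈ forbidden (clearPatterns G) := by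
    have hae : ∀ᵐ z ∂ρ.map Prod.fst, z ∈ forbidden (clearPatterns G) := by
      rw [hρfst]; exact hsupp
    exact ae_of_ae_map measurable_fst.aemeasurable hae
  have hDm : Measurable fun b : Config d Bool => upperDensity {k | b k = true} :=
    measurable_upperDensity measurableSet_cell_eq_true
  calc besicovitchDistTo (m.map (letterMap Prod.fst)) (sftMeasures G)
      ≤ ∫⁻ z, hammingBesicovitch (letterMap Prod.fst z) (letterMap Prod.snd z) ∂(ρ.map Q) :=
        (iInf₂_le _ hνG).trans (iInf₂_le _ hcoup)
    _ = ∫⁻ p, hammingBesicovitch (letterMap Prod.fst p.1) (blockCode r ψ p.2) ∂ρ :=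
        lintegral_map (measurable_hammingBesicovitch (measurable_letterMap measurable_fst)
          (measurable_letterMap measurable_snd)) hQm
    _ ≤ ∫⁻ p, ((box d n).card * 2 ^ d * upperDensity {k | letterMap Prod.snd p.1 k = true} +
          (box d r).card * 2 ^ d * hammingBesicovitch (Φ p.1) p.2) ∂ρ := by
        refine lintegral_mono_ae ?_
        filter_upwards [hρsupp] with p hp using h.hammingBesicovitch_le hp p.2
    _ = (box d n).card * 2 ^ d * ∫⁻ b, upperDensity {k | b k = true} ∂(m.map (letterMap Prod.snd)) +
          (box d r).card * 2 ^ d * ∫⁻ q, hammingBesicovitch q.1 q.2 ∂κ' := by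
        have hm1 : Measurable fun p : Config d (B × Bool) × Config d A =>
            upperDensity {k | letterMap Prod.snd p.1 k = true} :=
          hDm.comp (hbs.comp measurable_fst)
        have hm2 : Measurable fun p : Config d (B × Bool) × Config d A =>
            hammingBesicovitch (Φ p.1) p.2 :=
          measurable_hammingBesicovitch (hΦ.comp measurable_fst) measurable_snd
        rw [lintegral_add_left (hm1.const_mul _), lintegral_const_mul _ hm1,
          lintegral_const_mul _ hm2]
        congr 2
        · conv_rhs => rw [← hρfst, Measure.map_map hbs measurable_fst,
            lintegral_map hDm (hbs.comp measurable_fst)]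
          rfl
        · conv_rhs => rw [← map_glue hΦ hfst, lintegral_map
            (measurable_hammingBesicovitch measurable_fst measurable_snd)
            (hΦ.prodMap measurable_id)]
          rfl
    _ ≤ _ := by
        -- The maximal inequality turns the mean upper density of the noise into a multiple of `ε`.
        have h1 := (lintegral_upperDensity_le hmε.1).trans
          (mul_le_mul_right hmε.2 (2 * 2 ^ (4 * d)))
        have h2 : ∫⁻ q, hammingBesicovitch q.1 q.2 ∂κ' =
            ∫⁻ z, hammingBesicovitch (letterMap Prod.fst z) (letterMap Prod.snd z) ∂κ :=
          lintegral_map (measurable_hammingBesicovitch measurable_fst measurable_snd) hpm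
        rw [h2]
        gcongr

lemma IsNoisyInverse.besicovitchDistTo_le [Finite A] [DiscreteMeasurableSpace A]
    (h : IsNoisyInverse F G ψ χ n) (hG : G.Finite) {N : Set (Measure (Config d Bool))}
    {ε : unitInterval} {m : Measure (Config d (B × Bool))} (hm : m ∈ noisyMeasuresTilde G N ε) :
    besicovitchDistTo (m.map (letterMap Prod.fst)) (sftMeasures G) ≤
      (box d n).card * 2 ^ d * (2 * 2 ^ (4 * d) * ENNReal.ofReal ε) + (box d r).card * 2 ^ d *
        besicovitchDistTo ((m.map (noisyCode s χ n)).map (letterMap Prod.fst)) (sftMeasures F) := by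
  -- A nonzero finite factor commutes with infima, including those over empty families, which equal
  -- `∞`.
  have hb0 : ((box d r).card * 2 ^ d : ℝ≥0∞) ≠ 0 :=
    mul_ne_zero (card_box_ne_zero r) (pow_ne_zero _ two_ne_zero)
  have hbt : ((box d r).card * 2 ^ d : ℝ≥0∞) ≠ ∞ :=
    ENNReal.mul_ne_top (ENNReal.natCast_ne_top _) (ENNReal.pow_ne_top ENNReal.ofNat_ne_top)
  unfold besicovitchDistTo besicovitchDist
  simp_rw [ENNReal.mul_iInf_of_ne hb0 hbt, ENNReal.add_iInf]
  refine le_iInf₂ fun ν hν => le_iInf₂ fun κ hκ => ?_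
  exact h.besicovitchDistTo_le_of_coupling hG hm hν hκ

end Transfer

/-! ### Transfer of speeds -/

section Speed

/-- The speed `ε ↦ a * ε + b * f (min 1 (c * ε))`. -/
noncomputable def transferSpeed (a b c : ℕ) (f : unitInterval → ℝ≥0) (ε : unitInterval) : ℝ≥0 :=
  a * unitInterval.toNNReal ε + b * f (scale c ε)

lemma monotone_scale (c : ℕ) : Monotone (scale c) := fun ε δ h =>
  Set.monotone_projIcc _ (mul_le_mul_of_nonneg_left (by exact_mod_cast h) c.cast_nonneg)

lemma continuous_scale (c : ℕ) : Continuous (scale c) :=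
  continuous_projIcc.comp (continuous_const.mul continuous_subtype_val)

lemma scale_zero (c : ℕ) : scale c 0 = 0 := Subtype.ext (by simp [coe_scale])

lemma IsSpeed.transferSpeed {f : unitInterval → ℝ≥0} (hf : IsSpeed f) (a b c : ℕ) :
    IsSpeed (transferSpeed a b c f) where
  monotone ε δ h := by
    unfold NoisySFT.transferSpeed
    have h1 : unitInterval.toNNReal ε ≤ unitInterval.toNNReal δ := h
    have h2 := hf.monotone (monotone_scale c h)
    gcongr
  map_zero := by simp [NoisySFT.transferSpeed, scale_zero, hf.map_zero]
  continuousAt_zero := by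
    have h1 : ContinuousAt (fun ε => f (scale c ε)) 0 :=
      ContinuousAt.comp (by rw [scale_zero]; exact hf.continuousAt_zero)
        (continuous_scale c).continuousAt
    have h2 : ContinuousAt unitInterval.toNNReal 0 :=
      (Continuous.subtype_mk continuous_subtype_val _).continuousAt
    exact (continuousAt_const.mul h2).add (continuousAt_const.mul h1)

/-- A gauge `g` survives the transfer when it dominates the identity, which absorbs the added linear
term, and tolerates rescaling of its argument. -/
lemma isBigO_transferSpeed {f : unitInterval → ℝ≥0} {g : unitInterval → ℝ} (a b c : ℕ)
    (hf : (fun ε => (f ε : ℝ)) =O[𝓝 0] g)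
    (hid : (fun ε : unitInterval => (ε : ℝ)) =O[𝓝 0] g)
    (hg : (fun ε => g (scale c ε)) =O[𝓝 0] g) :
    (fun ε => (transferSpeed a b c f ε : ℝ)) =O[𝓝 0] g := by
  have ht : Filter.Tendsto (scale c) (𝓝 0) (𝓝 0) := by
    have := (continuous_scale c).tendsto 0
    rwa [scale_zero] at this
  have h1 : (fun ε => (f (scale c ε) : ℝ)) =O[𝓝 0] g := (hf.comp_tendsto ht).trans hg
  exact (hid.const_mul_left a).add (h1.const_mul_left b)

lemma isBigO_scale_rpow (c : ℕ) {α : ℝ} (hα : 0 < α) :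
    (fun ε => (scale c ε : ℝ) ^ α) =O[𝓝 0] fun ε : unitInterval => (ε : ℝ) ^ α := by
  refine Asymptotics.IsBigO.of_bound ((c : ℝ) ^ α) (Filter.Eventually.of_forall fun ε => ?_)
  rw [Real.norm_of_nonneg (Real.rpow_nonneg (scale c ε).2.1 _),
    Real.norm_of_nonneg (Real.rpow_nonneg ε.2.1 _), ← Real.mul_rpow c.cast_nonneg ε.2.1]
  exact Real.rpow_le_rpow (scale c ε).2.1 (by rw [coe_scale]; exact min_le_right _ _) hα.le

/-- On `[0, 1]` an exponent at most `1` can only enlarge the number; this is where the bound `α ≤ 1`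
enters. -/
lemma isBigO_id_rpow {α : ℝ} (h0 : 0 < α) (h1 : α ≤ 1) :
    (fun ε : unitInterval => (ε : ℝ)) =O[𝓝 0] fun ε : unitInterval => (ε : ℝ) ^ α := by
  refine Asymptotics.IsBigO.of_bound 1 (Filter.Eventually.of_forall fun ε => ?_)
  rw [Real.norm_of_nonneg ε.2.1, Real.norm_of_nonneg (Real.rpow_nonneg ε.2.1 _), one_mul]
  rcases ε.2.1.eq_or_lt with h | h
  · rw [← h, Real.zero_rpow h0.ne']
  · simpa using Real.rpow_le_rpow_of_exponent_ge h ε.2.2 h1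

end Speed

/-! ### Stability is invariant -/

section Stability

variable {d : ℕ} {A B : Type*} [Inhabited A] [Inhabited B]
  [MeasurableSpace A] [MeasurableSpace B]
  {F : Set (Pattern A (Grid d))} {G : Set (Pattern B (Grid d))}

/-- The speed of stability on `N` of the second subshift is controlled by that of the first. -/
def SpeedTransfer (F : Set (Pattern A (Grid d))) (G : Set (Pattern B (Grid d)))
    (N : Set (Measure (Config d Bool))) : Prop :=
  ∃ a b c : ℕ, ∀ f, IsSpeed f → StableWithSpeed F N f → StableWithSpeed G N (transferSpeed a b c f)

lemma SpeedTransfer.stable {N : Set (Measure (Config d Bool))} (h : SpeedTransfer F G N)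
    (hF : Stable F N) : Stable G N := by
  obtain ⟨a, b, c, h⟩ := h
  obtain ⟨f, hf, hs⟩ := hF
  exact ⟨_, hf.transferSpeed a b c, h f hf hs⟩

lemma SpeedTransfer.linearlyStable {N : Set (Measure (Config d Bool))} (h : SpeedTransfer F G N)
    (hF : LinearlyStable F N) : LinearlyStable G N := by
  obtain ⟨a, b, c, h⟩ := h
  obtain ⟨f, hf, hs, hO⟩ := hF
  exact ⟨_, hf.transferSpeed a b c, h f hf hs, isBigO_transferSpeed a b c hO
    (Asymptotics.isBigO_refl _ _) (by simpa using isBigO_scale_rpow c one_pos)⟩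

lemma SpeedTransfer.polynomiallyStable {N : Set (Measure (Config d Bool))}
    (h : SpeedTransfer F G N) (hF : PolynomiallyStable F N) : PolynomiallyStable G N := by
  obtain ⟨a, b, c, h⟩ := h
  obtain ⟨f, hf, hs, α, h0, h1, hO⟩ := hF
  exact ⟨_, hf.transferSpeed a b c, h f hf hs, α, h0, h1, isBigO_transferSpeed a b c hO
    (isBigO_id_rpow h0 h1) (isBigO_scale_rpow c h0)⟩

variable [Finite A] [Finite B] [DiscreteMeasurableSpace A] [DiscreteMeasurableSpace B]

lemma IsNoisyInverse.speedTransfer {r s n : ℕ} {ψ : (box d r → A) → B} {χ : (box d s → B) → A}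
    (h : IsNoisyInverse F G ψ χ n) (hF : F.Finite) (hG : G.Finite)
    {N : Set (Measure (Config d Bool))} (hN : ClosedUnderThickening N) : SpeedTransfer F G N := by
  -- The first constant pays for the noise near a cell (thickening, then the maximal inequality),
  -- the second for the reach of `ψ`, the third for the union bound on the thickened noise. None
  -- depends on `f`.
  refine ⟨(box d n).card * 2 ^ d * (2 * 2 ^ (4 * d)), (box d r).card * 2 ^ d, (box d n).card,
    fun f _ hs ε => iSup₂_le ?_⟩
  rintro _ ⟨m, hm, rfl⟩
  have hle : besicovitchDistTo ((m.map (noisyCode s χ n)).map (letterMap Prod.fst)) (sftMeasures F)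
      ≤ f (scale (box d n).card ε) :=
    (le_iSup₂ (f := fun μ (_ : μ ∈ noisyMeasures F N (scale (box d n).card ε)) =>
      besicovitchDistTo μ (sftMeasures F)) _ ⟨_, h.map_noisyCode_mem hF hN hm, rfl⟩).trans (hs _)
  refine (h.besicovitchDistTo_le hG hm).trans ((add_le_add_right
    (mul_le_mul_right hle _) _).trans (le_of_eq ?_))
  have hε : ENNReal.ofReal ε = (unitInterval.toNNReal ε : ℝ≥0∞) := by
    rw [ENNReal.ofReal, Real.toNNReal_of_nonneg ε.2.1]; rfl
  rw [hε, transferSpeed]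
  push_cast
  ring

variable [TopologicalSpace A] [DiscreteTopology A] [TopologicalSpace B] [DiscreteTopology B]

lemma speedTransfer_of_bijective {θ : forbidden F → forbidden G} (hθ : IsMorphism F G θ)
    (hb : Function.Bijective θ) (hF : F.Finite) (hG : G.Finite) (hne : (forbidden F).Nonempty)
    {N : Set (Measure (Config d Bool))} (hN : ClosedUnderThickening N) : SpeedTransfer F G N := by
  obtain ⟨r, ψ, hψ⟩ := hθ.exists_blockCode
  obtain ⟨s, χ, hχ⟩ := (hθ.symm_of_bijective hb).exists_blockCode
  obtain ⟨n, hn⟩ := exists_isNoisyInverse (ψ := ψ) (χ := χ) (G := G) hF hne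
    (fun x hx => by rw [hψ ⟨x, hx⟩]; exact (θ ⟨x, hx⟩).2)
    (fun y hy => by
      rw [hχ ⟨y, hy⟩]
      exact ((Equiv.ofBijective θ hb).symm ⟨y, hy⟩).2)
    (fun y hy => by
      rw [hχ ⟨y, hy⟩, hψ]
      exact congrArg Subtype.val ((Equiv.ofBijective θ hb).apply_symm_apply ⟨y, hy⟩))
  exact hn.speedTransfer hF hG hN

lemma Conjugate.speedTransfer (hconj : Conjugate F G) (hF : F.Finite) (hG : G.Finite)
    (hne : (forbidden F).Nonempty) {N : Set (Measure (Config d Bool))}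
    (hN : ClosedUnderThickening N) : SpeedTransfer F G N ∧ SpeedTransfer G F N := by
  obtain ⟨θ, hθ, hb⟩ := hconj
  obtain ⟨x, hx⟩ := hne
  -- The reverse transfer uses the inverse morphism, with the image of `x` as a point of the second
  -- subshift.
  exact ⟨speedTransfer_of_bijective hθ hb hF hG ⟨x, hx⟩ hN,
    speedTransfer_of_bijective (hθ.symm_of_bijective hb) (Equiv.bijective _) hG hF
      ⟨_, (θ ⟨x, hx⟩).2⟩ hN⟩

theorem Conjugate.stable_iff (hconj : Conjugate F G) (hF : F.Finite) (hG : G.Finite)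
    (hne : (forbidden F).Nonempty) {N : Set (Measure (Config d Bool))}
    (hN : ClosedUnderThickening N) :
    (Stable F N ↔ Stable G N) ∧ (LinearlyStable F N ↔ LinearlyStable G N) ∧
      (PolynomiallyStable F N ↔ PolynomiallyStable G N) := by
  obtain ⟨h1, h2⟩ := hconj.speedTransfer hF hG hne hN
  exact ⟨⟨h1.stable, h2.stable⟩, ⟨h1.linearlyStable, h2.linearlyStable⟩,
    ⟨h1.polynomiallyStable, h2.polynomiallyStable⟩⟩

end Stability

end NoisySFT


theorem mainTheorem6 {d : ℕ} (hd : 0 < d) {A₁ A₂ : Type*}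
    [Finite A₁] [Inhabited A₁] [TopologicalSpace A₁] [DiscreteTopology A₁]
    [MeasurableSpace A₁] [DiscreteMeasurableSpace A₁]
    [Finite A₂] [Inhabited A₂] [TopologicalSpace A₂] [DiscreteTopology A₂]
    [MeasurableSpace A₂] [DiscreteMeasurableSpace A₂]
    (F : Set (Pattern A₁ (NoisySFT.Grid d))) (G : Set (Pattern A₂ (NoisySFT.Grid d)))
    (hF : F.Finite) (hG : G.Finite)
    (hne : (forbidden F).Nonempty)
    (hconj : NoisySFT.Conjugate F G) :
    (∀ N : Set (Measure (NoisySFT.Config d Bool)),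
      N ⊆ NoisySFT.invariantMeasures d Bool → NoisySFT.ClosedUnderThickening N →
        (NoisySFT.Stable F N ↔ NoisySFT.Stable G N) ∧
        (NoisySFT.LinearlyStable F N ↔ NoisySFT.LinearlyStable G N) ∧
        (NoisySFT.PolynomiallyStable F N ↔ NoisySFT.PolynomiallyStable G N)) ∧
    (NoisySFT.ClosedUnderThickening (NoisySFT.invariantMeasures d Bool) ∧
      (NoisySFT.Stable F (NoisySFT.invariantMeasures d Bool) ↔
        NoisySFT.Stable G (NoisySFT.invariantMeasures d Bool)) ∧
      (NoisySFT.LinearlyStable F (NoisySFT.invariantMeasures d Bool) ↔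
        NoisySFT.LinearlyStable G (NoisySFT.invariantMeasures d Bool)) ∧
      (NoisySFT.PolynomiallyStable F (NoisySFT.invariantMeasures d Bool) ↔
        NoisySFT.PolynomiallyStable G (NoisySFT.invariantMeasures d Bool))) := by

  exact ⟨fun N _ hN => hconj.stable_iff hF hG hne hN,
    NoisySFT.closedUnderThickening_invariantMeasures,
    hconj.stable_iff hF hG hne NoisySFT.closedUnderThickening_invariantMeasures⟩
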